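/- **Setting.** Let $(\Omega,\mathcal F,\mathsf P)$ be a probability space and let $\mathcal P$ be the set of probability measures absolutely continuous with respect to $\mathsf P$. Expectations are $\mathsf E_{\mathsf Q}X=\mathsf E_{\mathsf Q}X^+-\mathsf E_{\mathsf Q}X^-$ with $\infty-\infty:=-\infty$. For $n=1,\dots,N$ let $u_n:L^0\to[-\infty,\infty]$ be a coherent utility function, i.e. $u_n(X)=\inf_{\mathsf Q\in\mathcal D}\mathsf E_{\mathsf Q}X$ for all $X\in L^0$ with some nonempty $\mathcal D\subseteq\mathcal P$, and assume that its determining set $\mathcal D_n$ (the largest such $\mathcal D$) is weakly compact, i.e. compact for $\sigma(L^1,L^\infty)$. For $\mathcal D\subseteq\mathcal P$ put $L^1_s(\mathcal D)=\{X\in L^0:\lim_{k\to\infty}\sup_{\mathsf Q\in\mathcal D}\mathsf E_{\mathsf Q}|X|I(|X|>k)=0\}$, and for $A\subseteq L^0$ put $\mathcal R(A)=\{\mathsf Q\in\mathcal P:\mathsf E_{\mathsf Q}X\le 0\ \ \forall X\in A\}$. Let $A_n\subseteq L^0$ be convex cones containing $0$ that are $\mathcal D_n$-consistent, i.e. $\mathcal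 D_n\cap\mathcal R(A_n)=\mathcal D_n\cap\mathcal R(A_n')$ for some $A_n'\subseteq A_n\cap L^1_s(\mathcal D_n)$. Let $W_n\in L^1_s(\mathcal D_n)$ and let $S=(S^1,\dots,S^d)$ have components in $\bigcap_nL^1_s(\mathcal D_n)$. An *allocation* is a pair $(X,h)$ with $X_n\in A_n$, $h_n\in\mathbb R^d$, $\sum_nh_n=0$. Put $$M=\sup_{(X,h)\text{ allocation}}\ \sum_{n=1}^Nu_n(W_n+X_n+\langle h_n,S\rangle)$$ (a sum with a summand $-\infty$ is $-\infty$), $$G_n=\mathrm{cl}\{\mathsf E_{\mathsf Q}S:\mathsf Q\in\mathcal D_n\cap\mathcal R(A_n)\},\quad \widetilde G_n=\mathrm{cl}\{\mathsf E_{\mathsf Q}(S,W_n):\mathsf Q\in\mathcal D_n\cap\mathcal R(A_n)\},\quad G=\bigcap_nG_n,\quad f_n(x)=\inf\{y:(x,y)\in\widetilde G_n\}.$$ An allocation $(X,h)$ is a *Pareto-type equilibrium* (global optimum) if $\sum_nu_n(W_n+X_n+\langle h_n,S\rangle)=M$. For $P\in\mathbb R^d$, $(X,h,P)$ is an *Arrow–Debreu-type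 equilibrium* if $(X,h)$ is an allocation and, for every $n$, $u_n(W_n+X_n+\langle h_n,S-P\rangle)=\max_{\xi\in A_n,\,\eta\in\mathbb R^d}u_n(W_n+\xi+\langle\eta,S-P\rangle)$. Put $E(X,h)=\{P:(X,h,P)\text{ is an Arrow–Debreu-type equilibrium}\}$ and $\mathcal X_{\mathcal D}(Y)=\{\mathsf Q\in\mathcal D:\mathsf E_{\mathsf Q}Y=\inf_{\mathsf Q'\in\mathcal D}\mathsf E_{\mathsf Q'}Y\in(-\infty,\infty)\}$. **Theorem.** $M<\infty$ if and only if $G\ne\emptyset$. Assume $M<\infty$ and let $(X,h)$ be an allocation. 1. The following are equivalent: (i) $(X,h)$ is a Pareto-type equilibrium; (ii) there is $P\in\mathbb R^d$ such that $(X,h,P)$ is an Arrow–Debreu-type equilibrium. 2. If (i) holds, then $E(X,h)=\operatorname{argmin}_{x\in G}\sum_nf_n(x)$. 3. If every $A_n$ is a linear space, then (i) and (ii) are equivalent to (iii) $\bigcap_n\{\mathsf E_{\mathsf Q}S:\mathsf Q\in\mathcal X_{\mathcal D_n}(W_n+X_n+\langle h_n,S\rangle)\cap\mathcal R(A_n)\}\neq\emptyset$,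 and $E(X,h)=\bigcap_n\{\mathsf E_{\mathsf Q}S:\mathsf Q\in\mathcal X_{\mathcal D_n}(W_n+X_n+\langle h_n,S\rangle)\cap\mathcal R(A_n)\}$. 4. (i) is equivalent to: there are no allocation $(X',h')$ and $a\in\mathbb R^N$ with $\sum_na_n=0$ such that $u_n(W_n+X'_n+\langle h'_n,S\rangle+a_n)\ge u_n(W_n+X_n+\langle h_n,S\rangle)$ for all $n$, with strict inequality for some $n$. In particular (i) implies the same with $a=0$ (no allocation dominates $(X,h)$), and if $\langle v,S\rangle=1$ a.s. for some $v\in\mathbb R^d$, then (i) is equivalent to the latter. -/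

import Mathlib

open MeasureTheory Filter Topology
open scoped ENNReal

noncomputable section

namespace CoherentRisk

variable {Ω : Type*} [MeasurableSpace Ω]

/-- The probability measures that are absolutely continuous with respect to `P`. -/
abbrev ACProb (P : Measure Ω) : Type _ :=
  {Q : Measure Ω // IsProbabilityMeasure Q ∧ Q ≪ P}

/-- `E_Q X = E_Q X⁺ - E_Q X⁻` for `X ∈ L⁰(P)`, with the convention `∞ - ∞ = -∞`
(which is how subtraction works in `EReal`). -/
def expect {P : Measure Ω} (Q : ACProb P) (X : Ω →ₘ[P] ℝ) : EReal :=
  ((∫⁻ ω, ENNReal.ofReal (X ω) ∂Q.1 : ℝ≥0∞) : EReal) -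
    ((∫⁻ ω, ENNReal.ofReal (-X ω) ∂Q.1 : ℝ≥0∞) : EReal)

/-- The weak topology `σ(L¹(P), L^∞(P))`, restricted to the absolutely continuous probability
measures, a measure `Q` being identified with its density `dQ/dP ∈ L¹(P)`: it is the coarsest
topology for which `Q ↦ E_P [f dQ/dP] = E_Q f` is continuous for every `f ∈ L^∞(P)`. -/
@[reducible] def weakTopology (P : Measure Ω) : TopologicalSpace (ACProb P) :=
  TopologicalSpace.induced (fun Q (f : Lp ℝ ∞ P) => ∫ ω, f ω ∂Q.1) inferInstance

/-- Weak compactness of a set of absolutely continuous probability measures. -/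
def IsWeaklyCompact {P : Measure Ω} (D : Set (ACProb P)) : Prop :=
  @IsCompact _ (weakTopology P) D

/-- The set `D` represents `u`: `u(X) = inf_{Q ∈ D} E_Q X` for all `X ∈ L⁰`. -/
def Represents {P : Measure Ω} (D : Set (ACProb P)) (u : (Ω →ₘ[P] ℝ) → EReal) : Prop :=
  D.Nonempty ∧ ∀ X, u X = ⨅ Q ∈ D, expect Q X

/-- Coherent utility functions on `L⁰`. -/
def IsCoherentUtility {P : Measure Ω} (u : (Ω →ₘ[P] ℝ) → EReal) : Prop :=
  ∃ D : Set (ACProb P), Represents D u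

/-- The determining set of a coherent utility function: the largest set that represents it
(see `isGreatest_determiningSet`). -/
def determiningSet {P : Measure Ω} (u : (Ω →ₘ[P] ℝ) → EReal) : Set (ACProb P) :=
  {Q | ∀ X, u X ≤ expect Q X}

theorem isGreatest_determiningSet {P : Measure Ω} {u : (Ω →ₘ[P] ℝ) → EReal}
    (hu : IsCoherentUtility u) :
    IsGreatest {D : Set (ACProb P) | Represents D u} (determiningSet u) := by
  have key : ∀ D : Set (ACProb P), Represents D u → D ⊆ determiningSet u := by
    intro D hD Q hQ X
    rw [hD.2 X]
    exact iInf₂_le Q hQ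
  refine ⟨?_, fun D hD => key D hD⟩
  obtain ⟨D, hD⟩ := hu
  refine ⟨hD.1.mono (key D hD), fun X => le_antisymm (le_iInf₂ fun Q hQ => hQ X) ?_⟩
  rw [hD.2 X]
  exact biInf_mono (key D hD)

/-- The space `L_s¹(D)` of the `X ∈ L⁰` with
`sup_{Q ∈ D} E_Q |X| I(|X| > k) → 0` as `k → ∞`. -/
def StrongL1 {P : Measure Ω} (D : Set (ACProb P)) : Set (Ω →ₘ[P] ℝ) :=
  {X | Tendsto (fun k : ℕ => ⨆ Q ∈ D, ∫⁻ ω in {ω | (k : ℝ) < |X ω|}, ENNReal.ofReal |X ω| ∂Q.1)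
    atTop (𝓝 0)}

/-- The set `ℛ(A)` of risk-neutral measures: `E_Q X ≤ 0` for all `X ∈ A`. -/
def riskNeutral {P : Measure Ω} (A : Set (Ω →ₘ[P] ℝ)) : Set (ACProb P) :=
  {Q | ∀ X ∈ A, expect Q X ≤ 0}

/-- `A` is `D`-consistent: the measures of `D` that are risk-neutral for `A` are determined by
a subset of `A ∩ L_s¹(D)`. -/
def IsConsistent {P : Measure Ω} (D : Set (ACProb P)) (A : Set (Ω →ₘ[P] ℝ)) : Prop :=
  ∃ A' : Set (Ω →ₘ[P] ℝ), A' ⊆ A ∩ StrongL1 D ∧ D ∩ riskNeutral A = D ∩ riskNeutral A'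

/-- The set `𝒳_D(X)` of extreme measures:
those `Q ∈ D` with `E_Q X = inf_{Q' ∈ D} E_{Q'} X ∈ (-∞, ∞)`. -/
def extremeMeasures {P : Measure Ω} (D : Set (ACProb P)) (X : Ω →ₘ[P] ℝ) : Set (ACProb P) :=
  {Q | Q ∈ D ∧ expect Q X = (⨅ Q' ∈ D, expect Q' X) ∧ expect Q X ≠ ⊥ ∧ expect Q X ≠ ⊤}

/-- The vector `E_Q S`; it is used only where the components of `S` are `Q`-integrable. -/
def meanVec {P : Measure Ω} {d : ℕ} (Q : ACProb P) (S : Fin d → (Ω →ₘ[P] ℝ)) : Fin d → ℝ :=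
  fun i => ∫ ω, S i ω ∂Q.1

/-- The random variable `⟨h, S⟩ = ∑ i, hⁱ Sⁱ`. -/
def pair {P : Measure Ω} {d : ℕ} (h : Fin d → ℝ) (S : Fin d → (Ω →ₘ[P] ℝ)) : Ω →ₘ[P] ℝ :=
  ∑ i, h i • S i

/-- The random vector `S - p`, where `p` is a deterministic vector. -/
def shift {P : Measure Ω} {d : ℕ} (S : Fin d → (Ω →ₘ[P] ℝ)) (p : Fin d → ℝ) :
    Fin d → (Ω →ₘ[P] ℝ) :=
  fun i => S i - AEEqFun.const Ω (p i)

/-- `A` is a linear space. -/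
def IsLinear {P : Measure Ω} (A : Set (Ω →ₘ[P] ℝ)) : Prop :=
  ∃ V : Submodule ℝ (Ω →ₘ[P] ℝ), (V : Set (Ω →ₘ[P] ℝ)) = A

section Equilibrium

/-! `N` agents with utilities `u n`, cones `A n` of attainable P&Ls and endowments `W n`
exchange `d` contracts with payoffs `S`. -/

variable {P : Measure Ω} {N d : ℕ}
  (u : Fin N → (Ω →ₘ[P] ℝ) → EReal) (A : Fin N → PointedCone ℝ (Ω →ₘ[P] ℝ))
  (W : Fin N → (Ω →ₘ[P] ℝ)) (S : Fin d → (Ω →ₘ[P] ℝ))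

/-- `X n ∈ A n` for all `n`, and `∑ n, h n = 0`. -/
def IsAllocation (X : Fin N → (Ω →ₘ[P] ℝ)) (h : Fin N → Fin d → ℝ) : Prop :=
  (∀ n, X n ∈ A n) ∧ ∑ n, h n = 0

/-- `∑ n, u n (W n + X n + ⟨h n, S⟩)`; a sum in `EReal` with a summand `-∞` is `-∞`. -/
def overallUtility (X : Fin N → (Ω →ₘ[P] ℝ)) (h : Fin N → Fin d → ℝ) : EReal :=
  ∑ n, u n (W n + X n + pair (h n) S)

/-- The maximal overall utility `M`. -/
def maxOverallUtility : EReal :=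
  ⨆ (X : Fin N → (Ω →ₘ[P] ℝ)) (h : Fin N → Fin d → ℝ) (_ : IsAllocation A X h),
    overallUtility u W S X h

/-- The set `D n ∩ ℛ(A n)`, where `D n` is the determining set of `u n`. -/
def pricingMeasures (n : Fin N) : Set (ACProb P) :=
  determiningSet (u n) ∩ riskNeutral (A n : Set (Ω →ₘ[P] ℝ))

/-- `G n = cl {E_Q S : Q ∈ D n ∩ ℛ(A n)}`. -/
def agentGen (n : Fin N) : Set (Fin d → ℝ) :=
  closure ((fun Q => meanVec Q S) '' pricingMeasures u A n)

/-- `G̃ n = cl {E_Q (S, W n) : Q ∈ D n ∩ ℛ(A n)}`. -/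
def agentGenExt (n : Fin N) : Set ((Fin d → ℝ) × ℝ) :=
  closure ((fun Q => (meanVec Q S, ∫ ω, W n ω ∂Q.1)) '' pricingMeasures u A n)

/-- `f n x = inf {y : (x, y) ∈ G̃ n}`. -/
def agentFun (n : Fin N) (x : Fin d → ℝ) : EReal :=
  ⨅ (y : ℝ) (_ : (x, y) ∈ agentGenExt u A W S n), (y : EReal)

/-- `G = ⋂ n, G n`. -/
def gen : Set (Fin d → ℝ) := ⋂ n, agentGen u A S n

/-- `argmin_{x ∈ G} ∑ n, f n x`. -/
def argminPrices : Set (Fin d → ℝ) :=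
  {x | x ∈ gen u A S ∧
    ∀ y ∈ gen u A S, ∑ n, agentFun u A W S n x ≤ ∑ n, agentFun u A W S n y}

/-- Pareto-type equilibrium (global optimum): an allocation with overall utility `M`. -/
def IsParetoEquilibrium (X : Fin N → (Ω →ₘ[P] ℝ)) (h : Fin N → Fin d → ℝ) : Prop :=
  IsAllocation A X h ∧ overallUtility u W S X h = maxOverallUtility u A W S

/-- No other allocation makes an agent better off and no agent worse off. -/
def IsUndominated (X : Fin N → (Ω →ₘ[P] ℝ)) (h : Fin N → Fin d → ℝ) : Prop :=
  IsAllocation A X h ∧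
    ¬ ∃ (X' : Fin N → (Ω →ₘ[P] ℝ)) (h' : Fin N → Fin d → ℝ), IsAllocation A X' h' ∧
      (∀ n, u n (W n + X n + pair (h n) S) ≤ u n (W n + X' n + pair (h' n) S)) ∧
      ∃ n, u n (W n + X n + pair (h n) S) < u n (W n + X' n + pair (h' n) S)

/-- No other allocation, combined with deterministic cash transfers `a n` between the agents,
`∑ n, a n = 0`, makes an agent better off and no agent worse off. -/
def IsUndominatedWithTransfers (X : Fin N → (Ω →ₘ[P] ℝ)) (h : Fin N → Fin d → ℝ) : Prop :=
  IsAllocation A X h ∧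
    ¬ ∃ (X' : Fin N → (Ω →ₘ[P] ℝ)) (h' : Fin N → Fin d → ℝ) (a : Fin N → ℝ),
      IsAllocation A X' h' ∧ ∑ n, a n = 0 ∧
      (∀ n, u n (W n + X n + pair (h n) S) ≤
        u n (W n + X' n + pair (h' n) S + AEEqFun.const Ω (a n))) ∧
      ∃ n, u n (W n + X n + pair (h n) S) <
        u n (W n + X' n + pair (h' n) S + AEEqFun.const Ω (a n))

/-- Arrow–Debreu-type equilibrium with price vector `p`. -/
def IsArrowDebreuEquilibrium (X : Fin N → (Ω →ₘ[P] ℝ)) (h : Fin N → Fin d → ℝ)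
    (p : Fin d → ℝ) : Prop :=
  IsAllocation A X h ∧
    ∀ n, ∀ ξ ∈ A n, ∀ η : Fin d → ℝ,
      u n (W n + ξ + pair η (shift S p)) ≤ u n (W n + X n + pair (h n) (shift S p))

/-- The set `E(X, h)` of equilibrium prices. -/
def equilibriumPrices (X : Fin N → (Ω →ₘ[P] ℝ)) (h : Fin N → Fin d → ℝ) : Set (Fin d → ℝ) :=
  {p | IsArrowDebreuEquilibrium u A W S X h p}

/-- `⋂ n, {E_Q S : Q ∈ 𝒳_{D n}(W n + X n + ⟨h n, S⟩) ∩ ℛ(A n)}`. -/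
def dualPrices (X : Fin N → (Ω →ₘ[P] ℝ)) (h : Fin N → Fin d → ℝ) : Set (Fin d → ℝ) :=
  ⋂ n, (fun Q => meanVec Q S) ''
    (extremeMeasures (determiningSet (u n)) (W n + X n + pair (h n) S) ∩
      riskNeutral (A n : Set (Ω →ₘ[P] ℝ)))

end Equilibrium

end CoherentRisk

end

/-! The theorem is convex duality between allocations and pricing measures. Utilities are cash
invariant (`utility_add_const`) and the holdings `h n` add up to zero, so for every price `p` the
overall utility equals the sum of the utilities with `S` replaced by `S - p`
(`overallUtility_eq_sum_shift`).

Weak duality: testing agent `n`'s utility with a risk-neutral `Q` in the determining set with `E_Q S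
= p` bounds it by `E_Q W_n`, hence by `f_n(p)` (`utility_shift_le_agentFun`). So `M ≤ ∑ f_n(p)` for
every `p`.

Strong duality: if `M < ∞`, there are risk-neutral `Q_n` with a common mean `p` of `S` and `∑
E_{Q_n} W_n ≤ M` (`exists_common_pricing`), so `p ∈ G` and `∑ f_n(p) ≤ M`. This rests on a minimax
argument (`exists_feasible_le`): means of `L_s¹` variables are weakly continuous on the compact
determining sets, so finitely many constraints suffice, and these are handled by separation in
finite dimension.

The rest compares the two bounds. At a dual optimal `p`, a global optimum attains equality in the
sum of the weak inequalities, hence in each of them, so every agent is at a maximum; conversely,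
individual maxima add up to a global one. Duality for a single agent turns an equilibrium price into
extreme risk-neutral measures; for linear `A n` the converse holds because `-X n` is attainable too.
Finally, cash transfers can redistribute any gain in overall utility so that no agent loses. -/

namespace CoherentRisk

/-! ### Lagrange duality on a compact space. -/

section Minimax

variable {T V : Type*} [TopologicalSpace T] [AddCommGroup V] [Module ℝ V]

/-- Strict separation of `K` from the nonpositive orthant. The orthant is a cone, so a functional
bounded below on it has a sign there, and this makes the coefficients nonnegative. -/
theorem exists_nonneg_coeff_of_disjoint {t : Type*} [Fintype t] [DecidableEq t]
    {K : Set (ℝ × (t → ℝ))} (hK : IsCompact K) (hconv : Convex ℝ K) (hdisj : Disjoint K (Set.Iic 0)) :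
    ∃ (a : ℝ) (b : t → ℝ) (ε : ℝ), 0 ≤ a ∧ (∀ i, 0 ≤ b i) ∧ 0 < ε ∧
      ∀ x ∈ K, ε ≤ a * x.1 + ∑ i, b i * x.2 i := by
  obtain ⟨f, s, r, hfK, hsr, hf⟩ :=
    geometric_hahn_banach_compact_closed hconv hK (convex_Iic 0) isClosed_Iic hdisj
  have hr : r < 0 := by simpa using hf 0 Set.self_mem_Iic
  have hneg : ∀ x : ℝ × (t → ℝ), 0 ≤ x → 0 ≤ -f x := by
    intro x hx
    by_contra! hlt
    have hpos : 0 < f x := by linarith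
    -- This multiple of `x` lies in the orthant and `f` equals `r` on it, against the strict bound
    -- `r < f`.
    have hmem : (r / f x) • x ∈ Set.Iic (0 : ℝ × (t → ℝ)) :=
      smul_nonpos_of_nonpos_of_nonneg (div_nonpos_of_nonpos_of_nonneg hr.le hpos.le) hx
    have h := hf _ hmem
    rw [map_smul, smul_eq_mul, div_mul_cancel₀ _ hpos.ne'] at h
    exact lt_irrefl _ h
  refine ⟨-f (1, 0), fun i => -f (0, Pi.single i 1), -s, hneg _ ⟨zero_le_one, le_rfl⟩,
    fun i => hneg _ ⟨le_rfl, Pi.single_nonneg.2 zero_le_one⟩, by linarith, fun x hx => ?_⟩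
  have hx' : x = x.1 • (1, 0) + ∑ i, x.2 i • ((0, Pi.single i 1) : ℝ × (t → ℝ)) := by
    ext i
    · simp [Prod.fst_sum]
    · simp [Prod.snd_sum, Finset.sum_apply, Pi.single_apply]
  have hfx : f x = x.1 * f (1, 0) + ∑ i, x.2 i * f (0, Pi.single i 1) := by
    conv_lhs => rw [hx']
    simp only [map_add, map_sum, map_smul, smul_eq_mul]
  have h := hfK x hx
  rw [hfx] at h
  have hs : ∑ i, -f (0, Pi.single i 1) * x.2 i = -∑ i, x.2 i * f (0, Pi.single i 1) := by
    rw [← Finset.sum_neg_distrib]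
    exact Finset.sum_congr rfl fun i _ => by ring
  rw [hs]
  linarith

/-- Lagrange duality over a cone of constraints: if the penalized problem has value at most `m`
for every multiplier `c ∈ C`, then there is a feasible point with value at most `m`. -/
theorem exists_feasible_le [CompactSpace T] [Nonempty T] (C : PointedCone ℝ V) (φ : T → ℝ)
    (ℓ : T → V →ₗ[ℝ] ℝ) (hφ : Continuous φ) (hℓ : ∀ c, Continuous fun Q => ℓ Q c)
    (hconv : ∀ Q Q' : T, ∀ a b : ℝ, 0 ≤ a → 0 ≤ b → a + b = 1 →
      ∃ R, φ R = a * φ Q + b * φ Q' ∧ ∀ c, ℓ R c = a * ℓ Q c + b * ℓ Q' c)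
    {m : ℝ} (h : ∀ c ∈ C, ∃ Q, φ Q + ℓ Q c ≤ m) :
    ∃ Q, φ Q ≤ m ∧ ∀ c ∈ C, ℓ Q c ≤ 0 := by
  classical
  -- The bound on `φ` is repeated in every set of the family; it is recovered from the index `0 ∈
  -- C`.
  suffices hne : (Set.univ ∩ ⋂ c : C, {Q | φ Q ≤ m ∧ ℓ Q c ≤ 0}).Nonempty by
    obtain ⟨Q, -, hQ⟩ := hne
    rw [Set.mem_iInter] at hQ
    exact ⟨Q, (hQ 0).1, fun c hc => (hQ ⟨c, hc⟩).2⟩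
  refine isCompact_univ.inter_iInter_nonempty _ (fun c => ?_) fun t => ?_
  · exact (isClosed_le hφ continuous_const).inter (isClosed_le (hℓ c) continuous_const)
  by_contra hempty
  let F : T → ℝ × (t → ℝ) := fun Q => (φ Q - m, fun c => ℓ Q c)
  have hF : Continuous F := by
    refine (hφ.sub continuous_const).prodMk (continuous_pi fun c => hℓ c)
  have hFconv : Convex ℝ (Set.range F) := by
    rintro _ ⟨Q, rfl⟩ _ ⟨Q', rfl⟩ a b ha hb hab
    obtain ⟨R, hR, hR'⟩ := hconv Q Q' a b ha hb hab
    refine ⟨R, Prod.ext ?_ (funext fun c => ?_)⟩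
    · change φ R - m = a * (φ Q - m) + b * (φ Q' - m)
      rw [hR]
      linear_combination m * hab
    · exact hR' c
  have hdisj : Disjoint (Set.range F) (Set.Iic 0) := by
    rw [Set.disjoint_left]
    rintro _ ⟨Q, rfl⟩ hQ
    refine hempty ⟨Q, Set.mem_univ _, Set.mem_iInter₂.2 fun c hc => ⟨?_, ?_⟩⟩
    · exact sub_nonpos.1 hQ.1
    · exact hQ.2 ⟨c, hc⟩
  obtain ⟨a, b, ε, ha, hb, hε, hK⟩ :=
    exists_nonneg_coeff_of_disjoint (isCompact_range hF) hFconv hdisj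
  let c : V := ∑ i, b i • (i : V)
  have hc : c ∈ C := Submodule.sum_mem _ fun i _ => C.smul_mem (hb i) i.1.2
  have hcK : ∀ Q, ε ≤ a * (φ Q - m) + ℓ Q c := fun Q => by
    refine (hK _ ⟨Q, rfl⟩).trans (le_of_eq ?_)
    simp only [F, c, map_sum, map_smul, smul_eq_mul]
  -- No constraint qualification is assumed, so the weight `a` of the objective may vanish. Then `ℓ
  -- Q c ≥ ε` for all `Q`, and a large multiple of `c` outweighs the lower bound `B` of `φ`.
  -- Otherwise `a⁻¹ • c` is a multiplier that contradicts `h`.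
  rcases ha.eq_or_lt with rfl | ha'
  · obtain ⟨B, hB⟩ : ∃ B, ∀ Q, B ≤ φ Q := by
      obtain ⟨Q₀, -, hQ₀⟩ := isCompact_univ.exists_isMinOn Set.univ_nonempty hφ.continuousOn
      exact ⟨φ Q₀, fun Q => hQ₀ (Set.mem_univ Q)⟩
    obtain ⟨n, hn⟩ := exists_nat_gt ((m - B) / ε)
    rw [div_lt_iff₀ hε] at hn
    obtain ⟨Q, hQ⟩ := h ((n : ℝ) • c) (C.smul_mem n.cast_nonneg hc)
    rw [map_smul, smul_eq_mul] at hQ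
    have h1 : (n : ℝ) * ε ≤ n * ℓ Q c :=
      mul_le_mul_of_nonneg_left (by simpa using hcK Q) n.cast_nonneg
    linarith [hB Q]
  · obtain ⟨Q, hQ⟩ := h (a⁻¹ • c) (C.smul_mem (inv_pos.2 ha').le hc)
    rw [map_smul, smul_eq_mul] at hQ
    have h1 : a * (φ Q + a⁻¹ * ℓ Q c) ≤ a * m := mul_le_mul_of_nonneg_left hQ ha
    rw [mul_add, mul_inv_cancel_left₀ ha'.ne'] at h1
    linarith [hcK Q]

end Minimax

end CoherentRisk
-- Finite sums of extended reals.
namespace EReal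

section ERealSums

variable {ι : Type*}

theorem coe_sum (s : Finset ι) (f : ι → ℝ) :
    ((∑ i ∈ s, f i : ℝ) : EReal) = ∑ i ∈ s, (f i : EReal) :=
  map_sum (⟨⟨Real.toEReal, EReal.coe_zero⟩, EReal.coe_add⟩ : ℝ →+ EReal) f s

theorem sum_ne_bot {f : ι → EReal} (s : Finset ι) (h : ∀ i, f i ≠ ⊥) :
    ∑ i ∈ s, f i ≠ ⊥ := by
  classical
  induction s using Finset.induction_on with
  | empty => simp
  | insert i s hi ih =>
    rw [Finset.sum_insert hi]
    simp [EReal.add_eq_bot_iff, h i, ih]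

variable [Fintype ι]

theorem sum_add_coe (f : ι → EReal) (r : ι → ℝ) :
    ∑ i, (f i + r i) = ∑ i, f i + ((∑ i, r i : ℝ) : EReal) := by
  rw [Finset.sum_add_distrib, EReal.coe_sum]

theorem ne_bot_of_sum_ne_bot {f : ι → EReal} (h : ∑ i, f i ≠ ⊥) (i : ι) : f i ≠ ⊥ := by
  classical
  intro hi
  rw [← Finset.add_sum_erase _ _ (Finset.mem_univ i), hi, EReal.bot_add] at h
  exact h rfl

theorem ne_top_of_sum_ne_top {f : ι → EReal} (h : ∀ i, f i ≠ ⊥) (h' : ∑ i, f i ≠ ⊤) (i : ι) :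
    f i ≠ ⊤ := by
  classical
  intro hi
  rw [← Finset.add_sum_erase _ _ (Finset.mem_univ i), hi,
    EReal.top_add_of_ne_bot (EReal.sum_ne_bot _ h)] at h'
  exact h' rfl

/-- Turns equality of totals into equality for each agent; finiteness of the smaller sum forces all
terms on both sides to be real. -/
theorem eq_of_le_of_sum_le {f g : ι → EReal} (hfg : ∀ i, f i ≤ g i)
    (hsum : ∑ i, g i ≤ ∑ i, f i) (hbot : ∑ i, f i ≠ ⊥) (htop : ∑ i, f i ≠ ⊤) (i : ι) :
    f i = g i := by
  have hf := EReal.ne_bot_of_sum_ne_bot hbot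
  have hg : ∀ i, g i ≠ ⊥ := fun i => ne_bot_of_le_ne_bot (hf i) (hfg i)
  have hf' := EReal.ne_top_of_sum_ne_top hf htop
  have hg' := EReal.ne_top_of_sum_ne_top hg (ne_top_of_le_ne_top htop hsum)
  lift f to ι → ℝ using fun i => ⟨hf' i, hf i⟩
  lift g to ι → ℝ using fun i => ⟨hg' i, hg i⟩
  simp only [EReal.coe_le_coe_iff] at hfg
  rw [← EReal.coe_sum, ← EReal.coe_sum, EReal.coe_le_coe_iff] at hsum
  exact congrArg Real.toEReal ((Finset.sum_eq_sum_iff_of_le fun i _ => hfg i).1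
    (le_antisymm (Finset.sum_le_sum fun i _ => hfg i) hsum) i (Finset.mem_univ i))

/-- A single index `j` absorbs the remainder. It has to be one with value `⊥` if such exists,
because the remainder can then be any real number. -/
theorem exists_sum_eq_of_sum_lt [Nonempty ι] {f : ι → EReal} (hf : ∀ i, f i ≠ ⊤) {r : ℝ}
    (h : ∑ i, f i < r) : ∃ c : ι → ℝ, ∑ i, c i = r ∧ ∀ i, f i ≤ c i := by
  classical
  obtain ⟨j, hj⟩ : ∃ j, f j = ⊥ ∨ ∀ i, f i ≠ ⊥ := by
    by_cases hb : ∃ j, f j = ⊥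
    · exact hb.imp fun j hj => Or.inl hj
    · exact ⟨Classical.arbitrary ι, Or.inr (not_exists.1 hb)⟩
  have hsum : ∑ i, (Function.update (fun i => (f i).toReal) j
      (r - ∑ i ∈ Finset.univ.erase j, (f i).toReal)) i = r := by
    rw [Finset.sum_update_of_mem (Finset.mem_univ j), Finset.sdiff_singleton_eq_erase]
    ring
  refine ⟨_, hsum, fun i => ?_⟩
  rcases eq_or_ne i j with rfl | hij
  · rw [Function.update_self]
    rcases hj with hj | hj
    · rw [hj]
      exact bot_le
    · lift f to ι → ℝ using fun i => ⟨hf i, hj i⟩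
      rw [← EReal.coe_sum, EReal.coe_lt_coe_iff,
        ← Finset.add_sum_erase _ _ (Finset.mem_univ i)] at h
      simp only [EReal.toReal_coe, EReal.coe_le_coe_iff]
      linarith
  · rw [Function.update_of_ne hij]
    exact EReal.le_coe_toReal (hf i)

end ERealSums

end EReal

namespace CoherentRisk

/-! ### Expectations, the space `L_s¹(D)`, weak continuity and mixtures. -/

section Expectation

variable {Ω : Type*} [MeasurableSpace Ω] {P : Measure Ω}

instance (Q : ACProb P) : IsProbabilityMeasure Q.1 := Q.2.1

theorem coeFn_add_ae (Q : ACProb P) (X Y : Ω →ₘ[P] ℝ) :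
    ∀ᵐ ω ∂Q.1, (X + Y) ω = X ω + Y ω := by
  filter_upwards [Q.2.2.ae_le (AEEqFun.coeFn_add X Y)] with ω hω
  simpa using hω

theorem coeFn_neg_ae (Q : ACProb P) (X : Ω →ₘ[P] ℝ) : ∀ᵐ ω ∂Q.1, (-X) ω = -X ω := by
  filter_upwards [Q.2.2.ae_le (AEEqFun.coeFn_neg X)] with ω hω
  simpa using hω

theorem coeFn_smul_ae (Q : ACProb P) (c : ℝ) (X : Ω →ₘ[P] ℝ) :
    ∀ᵐ ω ∂Q.1, (c • X) ω = c * X ω := by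
  filter_upwards [Q.2.2.ae_le (AEEqFun.coeFn_smul c X)] with ω hω
  simpa using hω

theorem coeFn_const_ae (Q : ACProb P) (c : ℝ) :
    ∀ᵐ ω ∂Q.1, (AEEqFun.const Ω c : Ω →ₘ[P] ℝ) ω = c := by
  filter_upwards [Q.2.2.ae_le (AEEqFun.coeFn_const Ω c (μ := P))] with ω hω
  simpa using hω

theorem measurable_coeFn (X : Ω →ₘ[P] ℝ) : Measurable X :=
  (AEEqFun.stronglyMeasurable X).measurable

theorem integrable_iff_lintegral_pos_neg (Q : ACProb P) (X : Ω →ₘ[P] ℝ) :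
    Integrable X Q.1 ↔ ∫⁻ ω, ENNReal.ofReal (X ω) ∂Q.1 ≠ ∞ ∧
      ∫⁻ ω, ENNReal.ofReal (-X ω) ∂Q.1 ≠ ∞ := by
  have hm := measurable_coeFn X
  have h : ∫⁻ ω, ENNReal.ofReal |X ω| ∂Q.1 =
      ∫⁻ ω, ENNReal.ofReal (X ω) ∂Q.1 + ∫⁻ ω, ENNReal.ofReal (-X ω) ∂Q.1 := by
    rw [← lintegral_add_left hm.ennreal_ofReal]
    refine lintegral_congr fun ω => ?_
    rcases le_total 0 (X ω) with h | h
    · rw [abs_of_nonneg h, ENNReal.ofReal_of_nonpos (neg_nonpos.2 h), add_zero]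
    · rw [abs_of_nonpos h, ENNReal.ofReal_of_nonpos h, zero_add]
  rw [← ENNReal.add_ne_top, ← h, ← lt_top_iff_ne_top]
  simp only [Integrable, hm.aestronglyMeasurable, true_and, hasFiniteIntegral_iff_norm,
    Real.norm_eq_abs]

theorem expect_of_integrable {Q : ACProb P} {X : Ω →ₘ[P] ℝ} (h : Integrable X Q.1) :
    expect Q X = ((∫ ω, X ω ∂Q.1 : ℝ) : EReal) := by
  obtain ⟨h1, h2⟩ := (integrable_iff_lintegral_pos_neg Q X).1 h
  rw [integral_eq_lintegral_pos_part_sub_lintegral_neg_part h, EReal.coe_sub,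
    EReal.coe_ennreal_toReal h1, EReal.coe_ennreal_toReal h2, expect]

theorem expect_eq_bot {Q : ACProb P} {X : Ω →ₘ[P] ℝ}
    (h : ∫⁻ ω, ENNReal.ofReal (-X ω) ∂Q.1 = ∞) : expect Q X = ⊥ := by
  rw [expect, h, EReal.coe_ennreal_top, EReal.sub_top]

theorem expect_eq_top {Q : ACProb P} {X : Ω →ₘ[P] ℝ}
    (h : ∫⁻ ω, ENNReal.ofReal (-X ω) ∂Q.1 ≠ ∞)
    (h' : ∫⁻ ω, ENNReal.ofReal (X ω) ∂Q.1 = ∞) : expect Q X = ⊤ := by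
  rw [expect, h', EReal.coe_ennreal_top, ← EReal.coe_ennreal_toReal h, EReal.top_sub_coe]

theorem integrable_of_expect_ne {Q : ACProb P} {X : Ω →ₘ[P] ℝ} (h : expect Q X ≠ ⊥)
    (h' : expect Q X ≠ ⊤) : Integrable X Q.1 := by
  have h1 : ∫⁻ ω, ENNReal.ofReal (-X ω) ∂Q.1 ≠ ∞ := fun h1 => h (expect_eq_bot h1)
  exact (integrable_iff_lintegral_pos_neg Q X).2 ⟨fun h2 => h' (expect_eq_top h1 h2), h1⟩

theorem integral_coeFn_add {Q : ACProb P} {X Y : Ω →ₘ[P] ℝ} (hX : Integrable X Q.1)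
    (hY : Integrable Y Q.1) :
    ∫ ω, (X + Y) ω ∂Q.1 = ∫ ω, X ω ∂Q.1 + ∫ ω, Y ω ∂Q.1 := by
  rw [integral_congr_ae (coeFn_add_ae Q X Y), integral_add hX hY]

theorem integrable_coeFn_add {Q : ACProb P} {X Y : Ω →ₘ[P] ℝ} (hX : Integrable X Q.1)
    (hY : Integrable Y Q.1) : Integrable (X + Y : Ω →ₘ[P] ℝ) Q.1 :=
  (hX.add hY).congr ((coeFn_add_ae Q X Y).mono fun ω hω => by simp [hω])

theorem integrable_coeFn_neg {Q : ACProb P} {X : Ω →ₘ[P] ℝ} (hX : Integrable X Q.1) :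
    Integrable (-X : Ω →ₘ[P] ℝ) Q.1 :=
  hX.neg.congr ((coeFn_neg_ae Q X).mono fun ω hω => by simp [hω])

theorem integral_coeFn_neg (Q : ACProb P) (X : Ω →ₘ[P] ℝ) :
    ∫ ω, (-X) ω ∂Q.1 = -∫ ω, X ω ∂Q.1 := by
  rw [integral_congr_ae (coeFn_neg_ae Q X), integral_neg]

theorem integrable_coeFn_const (Q : ACProb P) (c : ℝ) :
    Integrable (AEEqFun.const Ω c : Ω →ₘ[P] ℝ) Q.1 :=
  (integrable_const c).congr ((coeFn_const_ae Q c).mono fun ω hω => by simp [hω])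

theorem integral_coeFn_const (Q : ACProb P) (c : ℝ) :
    ∫ ω, (AEEqFun.const Ω c : Ω →ₘ[P] ℝ) ω ∂Q.1 = c := by
  rw [integral_congr_ae (coeFn_const_ae Q c)]
  simp

/-- Only the case where `Y⁻` and `(X + Y)⁺` are integrable has content; then `X + Y` is integrable,
and so is `Y = -X + (X + Y)`. Applying the inequality to `-X` and `X + Y` yields the reverse one. -/
theorem integral_add_expect_le {Q : ACProb P} {X Y : Ω →ₘ[P] ℝ} (hX : Integrable X Q.1) :
    ((∫ ω, X ω ∂Q.1 : ℝ) : EReal) + expect Q Y ≤ expect Q (X + Y) := by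
  by_cases hn : ∫⁻ ω, ENNReal.ofReal (-Y ω) ∂Q.1 = ∞
  · rw [expect_eq_bot hn, EReal.add_bot]
    exact bot_le
  have hXn := ((integrable_iff_lintegral_pos_neg Q X).1 hX).2
  have hn' : ∫⁻ ω, ENNReal.ofReal (-(X + Y) ω) ∂Q.1 ≠ ∞ := by
    refine ne_top_of_le_ne_top (ENNReal.add_ne_top.2 ⟨hXn, hn⟩) ?_
    have hm : Measurable fun ω => -X ω := (measurable_coeFn X).neg
    rw [← lintegral_add_left hm.ennreal_ofReal]
    refine lintegral_mono_ae ((coeFn_add_ae Q X Y).mono fun ω hω => ?_)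
    rw [hω, neg_add]
    exact ENNReal.ofReal_add_le
  by_cases hp : ∫⁻ ω, ENNReal.ofReal ((X + Y) ω) ∂Q.1 = ∞
  · rw [expect_eq_top hn' hp]
    exact le_top
  have hXY := (integrable_iff_lintegral_pos_neg Q (X + Y)).2 ⟨hp, hn'⟩
  have hY : Integrable Y Q.1 := by
    have := integrable_coeFn_add (integrable_coeFn_neg hX) hXY
    rwa [neg_add_cancel_left] at this
  rw [expect_of_integrable hY, expect_of_integrable hXY, integral_coeFn_add hX hY, EReal.coe_add]

/-- Adding an integrable random variable shifts the expectation. -/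
theorem expect_add {Q : ACProb P} {X Y : Ω →ₘ[P] ℝ} (hX : Integrable X Q.1) :
    expect Q (X + Y) = ((∫ ω, X ω ∂Q.1 : ℝ) : EReal) + expect Q Y := by
  refine le_antisymm ?_ (integral_add_expect_le hX)
  have h := integral_add_expect_le (Y := X + Y) (integrable_coeFn_neg hX)
  rw [neg_add_cancel_left, integral_coeFn_neg, EReal.coe_neg] at h
  calc expect Q (X + Y)
      = ((∫ ω, X ω ∂Q.1 : ℝ) : EReal) + (-((∫ ω, X ω ∂Q.1 : ℝ) : EReal) + expect Q (X + Y)) := by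
        rw [← add_assoc, ← EReal.coe_neg, ← EReal.coe_add, add_neg_cancel, EReal.coe_zero, zero_add]
    _ ≤ _ := by gcongr

/-! ### The space `L_s¹(D)` -/

/-- The excess `(|X| - k)⁺` is subadditive in `(X, k)`, unlike the truncated tail, which makes
linearity of `L_s¹(D)` immediate. It is at most the tail above `k`, while above `2k` one has `|X| ≤
2(|X| - k)`. -/
theorem mem_strongL1_iff {D : Set (ACProb P)} {X : Ω →ₘ[P] ℝ} :
    X ∈ StrongL1 D ↔ ∀ ε : ℝ≥0∞, 0 < ε → ∃ k : ℝ, 0 ≤ k ∧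
      ∀ Q ∈ D, ∫⁻ ω, ENNReal.ofReal (|X ω| - k) ∂Q.1 ≤ ε := by
  have hm : Measurable fun ω => |X ω| := (measurable_coeFn X).abs
  rw [StrongL1, Set.mem_ofPred_eq, ENNReal.tendsto_atTop_zero]
  constructor
  · intro h ε hε
    obtain ⟨k, hk⟩ := h ε hε
    refine ⟨k, k.cast_nonneg, fun Q hQ => ?_⟩
    refine le_trans ?_ ((le_iSup₂ (f := fun (Q : ACProb P) (_ : Q ∈ D) =>
      ∫⁻ ω in {ω | (k : ℝ) < |X ω|}, ENNReal.ofReal |X ω| ∂Q.1) Q hQ).trans (hk k le_rfl))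
    rw [← lintegral_indicator (measurableSet_lt measurable_const hm)]
    refine lintegral_mono fun ω => ?_
    by_cases hω : (k : ℝ) < |X ω|
    · rw [Set.indicator_of_mem (by exact hω)]
      exact ENNReal.ofReal_le_ofReal (by simp)
    · rw [ENNReal.ofReal_of_nonpos (by linarith)]
      exact zero_le
  · intro h ε hε
    obtain ⟨k, hk0, hk⟩ := h (ε / 2) (ENNReal.half_pos hε.ne')
    obtain ⟨n, hn⟩ := exists_nat_ge (2 * k)
    refine ⟨n, fun m hm' => iSup₂_le fun Q hQ => ?_⟩
    rw [← lintegral_indicator (measurableSet_lt measurable_const hm)]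
    calc _ ≤ ∫⁻ ω, 2 * ENNReal.ofReal (|X ω| - k) ∂Q.1 := by
          refine lintegral_mono (Set.indicator_le' (fun ω hω => ?_) fun _ _ => zero_le)
          have h1 : (m : ℝ) < |X ω| := hω
          have h2 : (n : ℝ) ≤ m := by exact_mod_cast hm'
          rw [← ENNReal.ofReal_ofNat 2, ← ENNReal.ofReal_mul (by norm_num)]
          exact ENNReal.ofReal_le_ofReal (by linarith)
      _ = 2 * ∫⁻ ω, ENNReal.ofReal (|X ω| - k) ∂Q.1 :=
          lintegral_const_mul _ (hm.sub_const k).ennreal_ofReal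
      _ ≤ 2 * (ε / 2) := by gcongr; exact hk Q hQ
      _ = ε := ENNReal.mul_div_cancel (by norm_num) (by norm_num)

theorem integrable_of_mem_strongL1 {D : Set (ACProb P)} {X : Ω →ₘ[P] ℝ} (hX : X ∈ StrongL1 D)
    {Q : ACProb P} (hQ : Q ∈ D) : Integrable X Q.1 := by
  obtain ⟨k, hk0, hk⟩ := mem_strongL1_iff.1 hX 1 one_pos
  refine ⟨(measurable_coeFn X).aestronglyMeasurable, ?_⟩
  rw [hasFiniteIntegral_iff_norm]
  calc ∫⁻ ω, ENNReal.ofReal ‖X ω‖ ∂Q.1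
      ≤ ∫⁻ ω, (ENNReal.ofReal (|X ω| - k) + ENNReal.ofReal k) ∂Q.1 := by
        refine lintegral_mono fun ω => ?_
        refine le_trans (le_of_eq ?_) ENNReal.ofReal_add_le
        simp
    _ = ∫⁻ ω, ENNReal.ofReal (|X ω| - k) ∂Q.1 + ENNReal.ofReal k := by
        rw [lintegral_add_right _ measurable_const]
        simp
    _ < ∞ := ENNReal.add_lt_top.2 ⟨(hk Q hQ).trans_lt ENNReal.one_lt_top, ENNReal.ofReal_lt_top⟩

theorem add_mem_strongL1 {D : Set (ACProb P)} {X Y : Ω →ₘ[P] ℝ} (hX : X ∈ StrongL1 D)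
    (hY : Y ∈ StrongL1 D) : X + Y ∈ StrongL1 D := by
  rw [mem_strongL1_iff] at hX hY ⊢
  intro ε hε
  obtain ⟨k, hk0, hk⟩ := hX (ε / 2) (ENNReal.half_pos hε.ne')
  obtain ⟨l, hl0, hl⟩ := hY (ε / 2) (ENNReal.half_pos hε.ne')
  refine ⟨k + l, add_nonneg hk0 hl0, fun Q hQ => ?_⟩
  calc ∫⁻ ω, ENNReal.ofReal (|(X + Y) ω| - (k + l)) ∂Q.1
      ≤ ∫⁻ ω, (ENNReal.ofReal (|X ω| - k) + ENNReal.ofReal (|Y ω| - l)) ∂Q.1 := by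
        refine lintegral_mono_ae ((coeFn_add_ae Q X Y).mono fun ω hω => ?_)
        refine le_trans (ENNReal.ofReal_le_ofReal ?_) ENNReal.ofReal_add_le
        rw [hω]
        linarith [abs_add_le (X ω) (Y ω)]
    _ = _ := lintegral_add_left ((measurable_coeFn X).abs.sub_const k).ennreal_ofReal _
    _ ≤ ε / 2 + ε / 2 := add_le_add (hk Q hQ) (hl Q hQ)
    _ = ε := ENNReal.add_halves ε

theorem const_mem_strongL1 (D : Set (ACProb P)) (c : ℝ) :
    (AEEqFun.const Ω c : Ω →ₘ[P] ℝ) ∈ StrongL1 D := by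
  rw [mem_strongL1_iff]
  refine fun ε _ => ⟨|c|, abs_nonneg c, fun Q _ => ?_⟩
  rw [lintegral_congr_ae ((coeFn_const_ae Q c).mono fun ω hω => by simp only [hω] :
    (fun ω => ENNReal.ofReal (|(AEEqFun.const Ω c : Ω →ₘ[P] ℝ) ω| - |c|)) =ᵐ[Q.1]
      fun _ => ENNReal.ofReal (|c| - |c|))]
  simp

theorem smul_mem_strongL1 {D : Set (ACProb P)} (c : ℝ) {X : Ω →ₘ[P] ℝ} (hX : X ∈ StrongL1 D) :
    c • X ∈ StrongL1 D := by
  rcases eq_or_ne c 0 with rfl | hc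
  · rw [zero_smul]
    exact const_mem_strongL1 D 0
  rw [mem_strongL1_iff] at hX ⊢
  intro ε hε
  have hc' : 0 < |c| := abs_pos.2 hc
  have h0 : ENNReal.ofReal |c| ≠ 0 := by simpa using hc
  obtain ⟨k, hk0, hk⟩ := hX (ε / ENNReal.ofReal |c|)
    (ENNReal.div_pos hε.ne' ENNReal.ofReal_ne_top)
  refine ⟨|c| * k, by positivity, fun Q hQ => ?_⟩
  calc ∫⁻ ω, ENNReal.ofReal (|(c • X) ω| - |c| * k) ∂Q.1
      = ∫⁻ ω, ENNReal.ofReal |c| * ENNReal.ofReal (|X ω| - k) ∂Q.1 := by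
        refine lintegral_congr_ae ((coeFn_smul_ae Q c X).mono fun ω hω => ?_)
        simp only [hω]
        rw [← ENNReal.ofReal_mul hc'.le, abs_mul, mul_sub]
    _ = ENNReal.ofReal |c| * ∫⁻ ω, ENNReal.ofReal (|X ω| - k) ∂Q.1 :=
        lintegral_const_mul _ ((measurable_coeFn X).abs.sub_const k).ennreal_ofReal
    _ ≤ ENNReal.ofReal |c| * (ε / ENNReal.ofReal |c|) := by gcongr; exact hk Q hQ
    _ = ε := ENNReal.mul_div_cancel h0 ENNReal.ofReal_ne_top

/-- `L_s¹(D)` as a linear space. -/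
def strongL1Submodule (D : Set (ACProb P)) : Submodule ℝ (Ω →ₘ[P] ℝ) where
  carrier := StrongL1 D
  add_mem' := add_mem_strongL1
  zero_mem' := const_mem_strongL1 D 0
  smul_mem' c _ hX := smul_mem_strongL1 c hX

/-- The expectation with respect to a measure of `D`, as a linear functional on `L_s¹(D)`. -/
noncomputable def meanFunctional {D : Set (ACProb P)} (Q : D) : strongL1Submodule D →ₗ[ℝ] ℝ where
  toFun X := ∫ ω, X.1 ω ∂Q.1.1
  map_add' X Y := integral_coeFn_add (integrable_of_mem_strongL1 X.2 Q.2)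
    (integrable_of_mem_strongL1 Y.2 Q.2)
  map_smul' c X := by
    change ∫ ω, (c • X.1) ω ∂Q.1.1 = c * ∫ ω, X.1 ω ∂Q.1.1
    rw [integral_congr_ae (coeFn_smul_ae Q.1 c X.1), integral_const_mul]

theorem meanFunctional_apply {D : Set (ACProb P)} (Q : D) (X : strongL1Submodule D) :
    meanFunctional Q X = ∫ ω, X.1 ω ∂Q.1.1 := rfl

attribute [local instance] weakTopology

theorem continuous_integral_of_bounded (X : Ω →ₘ[P] ℝ) (C : ℝ) (hX : ∀ᵐ ω ∂P, ‖X ω‖ ≤ C) :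
    Continuous fun Q : ACProb P => ∫ ω, X ω ∂Q.1 := by
  have hL : MemLp X ∞ P := memLp_top_of_bound (AEEqFun.aestronglyMeasurable X) C hX
  have h : Continuous fun Q : ACProb P => ∫ ω, hL.toLp X ω ∂Q.1 :=
    (continuous_apply (hL.toLp X)).comp
      (continuous_induced_dom (f := fun (Q : ACProb P) (f : Lp ℝ ∞ P) => ∫ ω, f ω ∂Q.1))
  refine h.congr fun Q => integral_congr_ae (Q.2.2.ae_le hL.coeFn_toLp)

/-- Truncating `X` at level `k` gives a bounded variable, whose mean is weakly continuous by
definition of the topology. The error is at most the mean of `(|X| - k)⁺`, small uniformly over `D`,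
and uniform limits of continuous functions are continuous. -/
theorem continuous_meanFunctional {D : Set (ACProb P)} (X : strongL1Submodule D) :
    Continuous fun Q : D => meanFunctional Q X := by
  refine continuous_of_uniform_approx_of_continuous fun V hV => ?_
  obtain ⟨ε, hε, hεV⟩ := Metric.mem_uniformity_dist.1 hV
  obtain ⟨k, hk0, hk⟩ := mem_strongL1_iff.1 X.2 (ENNReal.ofReal (ε / 2)) (by simpa using hε)
  set g : ℝ → ℝ := fun x => max (-k) (min x k) with hg
  have hgc : Continuous g := by fun_prop
  set Y : Ω →ₘ[P] ℝ := AEEqFun.comp g hgc X.1 with hY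
  have hgb : ∀ x, ‖g x‖ ≤ k := fun x => by
    rw [Real.norm_eq_abs, abs_le]
    exact ⟨le_max_left _ _, max_le (by linarith) (min_le_right _ _)⟩
  have hgd : ∀ x, ‖x - g x‖ ≤ max (|x| - k) 0 := fun x => by
    simp only [hg, Real.norm_eq_abs]
    rcases le_total x k with h1 | h1
    · rw [min_eq_left h1]
      rcases le_total x (-k) with h2 | h2
      · rw [max_eq_left h2, abs_of_nonpos (by linarith), abs_of_nonpos (by linarith)]
        exact (by linarith : _ ≤ _).trans (le_max_left _ _)
      · rw [max_eq_right h2]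
        simp
    · rw [min_eq_right h1, max_eq_right (by linarith), abs_of_nonneg (by linarith),
        abs_of_nonneg (by linarith)]
      exact le_max_left _ _
  have hYg : ∀ᵐ ω ∂P, Y ω = g (X.1 ω) := AEEqFun.coeFn_comp g hgc X.1
  have hYb : ∀ᵐ ω ∂P, ‖Y ω‖ ≤ k := hYg.mono fun ω hω => hω ▸ hgb _
  refine ⟨fun Q => ∫ ω, Y ω ∂Q.1.1,
    (continuous_integral_of_bounded Y k hYb).comp continuous_subtype_val, fun Q => ?_⟩
  have hXi := integrable_of_mem_strongL1 X.2 Q.2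
  have hYi : Integrable Y Q.1.1 := Integrable.of_bound
    (measurable_coeFn Y).aestronglyMeasurable k (Q.1.2.2.ae_le hYb)
  refine hεV ?_
  rw [meanFunctional_apply, dist_eq_norm, ← integral_sub hXi hYi]
  refine lt_of_le_of_lt ?_ (half_lt_self hε)
  rw [← ENNReal.ofReal_le_ofReal_iff (half_pos hε).le, ofReal_norm]
  refine (enorm_integral_le_lintegral_enorm _).trans (le_trans ?_ (hk Q.1 Q.2))
  have hYg' : ∀ᵐ ω ∂Q.1.1, Y ω = g (X.1 ω) := Q.1.2.2.ae_le hYg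
  refine lintegral_mono_ae (hYg'.mono fun ω hω => ?_)
  rw [hω, ← ofReal_norm]
  refine (ENNReal.ofReal_le_ofReal (hgd _)).trans (le_of_eq ?_)
  rcases le_total (|X.1 ω| - k) 0 with h | h
  · rw [max_eq_right h, ENNReal.ofReal_of_nonpos h, ENNReal.ofReal_zero]
  · rw [max_eq_left h]

/-! ### Mixtures -/

theorem exists_mixture (Q Q' : ACProb P) {a b : ℝ} (ha : 0 ≤ a) (hb : 0 ≤ b) (hab : a + b = 1) :
    ∃ Q₀ : ACProb P, Q₀.1 = ENNReal.ofReal a • Q.1 + ENNReal.ofReal b • Q'.1 := by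
  refine ⟨⟨ENNReal.ofReal a • Q.1 + ENNReal.ofReal b • Q'.1, ⟨?_⟩, ?_⟩, rfl⟩
  · simp [← ENNReal.ofReal_add ha hb, hab]
  · exact Measure.AbsolutelyContinuous.add_left
      (Q.2.2.smul_left _) (Q'.2.2.smul_left _)

theorem integral_mixture {Q Q' Q₀ : ACProb P} {a b : ℝ} (ha : 0 ≤ a) (hb : 0 ≤ b)
    (h₀ : Q₀.1 = ENNReal.ofReal a • Q.1 + ENNReal.ofReal b • Q'.1) {X : Ω → ℝ}
    (hX : Integrable X Q.1) (hX' : Integrable X Q'.1) :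
    ∫ ω, X ω ∂Q₀.1 = a * ∫ ω, X ω ∂Q.1 + b * ∫ ω, X ω ∂Q'.1 := by
  rw [h₀, integral_add_measure (hX.smul_measure ENNReal.ofReal_ne_top)
    (hX'.smul_measure ENNReal.ofReal_ne_top), integral_smul_measure, integral_smul_measure,
    ENNReal.toReal_ofReal ha, ENNReal.toReal_ofReal hb, smul_eq_mul, smul_eq_mul]

/-- If `u X ≠ ⊥`, then `X⁻` is integrable under `Q` and `Q'`, so `E_{Q₀} X` is `⊤` or finite. In the
finite case the strictly positive weights pass integrability from `Q₀` to both measures, and the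
inequalities average. -/
theorem mixture_mem_determiningSet {u : (Ω →ₘ[P] ℝ) → EReal} {Q Q' Q₀ : ACProb P} {a b : ℝ}
    (ha : 0 < a) (hb : 0 < b) (hab : a + b = 1)
    (h₀ : Q₀.1 = ENNReal.ofReal a • Q.1 + ENNReal.ofReal b • Q'.1)
    (hQ : Q ∈ determiningSet u) (hQ' : Q' ∈ determiningSet u) : Q₀ ∈ determiningSet u := by
  intro X
  by_cases hbot : u X = ⊥
  · rw [hbot]
    exact bot_le
  have hlin : ∀ f : Ω → ℝ≥0∞, ∫⁻ ω, f ω ∂Q₀.1 =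
      ENNReal.ofReal a * ∫⁻ ω, f ω ∂Q.1 + ENNReal.ofReal b * ∫⁻ ω, f ω ∂Q'.1 := fun f => by
    rw [h₀, lintegral_add_measure, lintegral_smul_measure, lintegral_smul_measure, smul_eq_mul,
      smul_eq_mul]
  have ha' : ENNReal.ofReal a ≠ 0 := by simpa using ha
  have hb' : ENNReal.ofReal b ≠ 0 := by simpa using hb
  have hn : ∀ Q ∈ determiningSet u, ∫⁻ ω, ENNReal.ofReal (-X ω) ∂Q.1 ≠ ∞ := fun Q hQ h =>
    hbot (le_bot_iff.1 ((hQ X).trans (expect_eq_bot h).le))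
  have hn₀ : ∫⁻ ω, ENNReal.ofReal (-X ω) ∂Q₀.1 ≠ ∞ := by
    rw [hlin]
    exact ENNReal.add_ne_top.2 ⟨ENNReal.mul_ne_top ENNReal.ofReal_ne_top (hn Q hQ),
      ENNReal.mul_ne_top ENNReal.ofReal_ne_top (hn Q' hQ')⟩
  by_cases hp : ∫⁻ ω, ENNReal.ofReal (X ω) ∂Q₀.1 = ∞
  · rw [expect_eq_top hn₀ hp]
    exact le_top
  have hp₀ := hp
  rw [hlin, ← Ne, ENNReal.add_ne_top] at hp
  have hi : Integrable X Q.1 := (integrable_iff_lintegral_pos_neg Q X).2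
    ⟨fun h => hp.1 (by rw [h, ENNReal.mul_top ha']), hn Q hQ⟩
  have hi' : Integrable X Q'.1 := (integrable_iff_lintegral_pos_neg Q' X).2
    ⟨fun h => hp.2 (by rw [h, ENNReal.mul_top hb']), hn Q' hQ'⟩
  have hi₀ : Integrable X Q₀.1 := (integrable_iff_lintegral_pos_neg Q₀ X).2 ⟨hp₀, hn₀⟩
  have h := hQ X
  have h' := hQ' X
  rw [expect_of_integrable hi] at h
  rw [expect_of_integrable hi'] at h'
  rw [expect_of_integrable hi₀, integral_mixture ha.le hb.le h₀ hi hi']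
  lift u X to ℝ using ⟨ne_top_of_le_ne_top (EReal.coe_ne_top _) h, hbot⟩ with r hr
  norm_cast at h h' ⊢
  calc r = a * r + b * r := by rw [← add_mul, hab, one_mul]
    _ ≤ _ := by gcongr

theorem exists_mem_determiningSet_integral_eq {u : (Ω →ₘ[P] ℝ) → EReal} {Q Q' : ACProb P}
    (hQ : Q ∈ determiningSet u) (hQ' : Q' ∈ determiningSet u)
    {a b : ℝ} (ha : 0 ≤ a) (hb : 0 ≤ b) (hab : a + b = 1) :
    ∃ Q₀ ∈ determiningSet u, ∀ X : Ω → ℝ, Integrable X Q.1 → Integrable X Q'.1 →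
      ∫ ω, X ω ∂Q₀.1 = a * ∫ ω, X ω ∂Q.1 + b * ∫ ω, X ω ∂Q'.1 := by
  rcases ha.eq_or_lt with rfl | ha'
  · obtain rfl : b = 1 := by linarith
    exact ⟨Q', hQ', by simp⟩
  rcases hb.eq_or_lt with rfl | hb'
  · obtain rfl : a = 1 := by linarith
    exact ⟨Q, hQ, by simp⟩
  obtain ⟨Q₀, h₀⟩ := exists_mixture Q Q' ha hb hab
  exact ⟨Q₀, mixture_mem_determiningSet ha' hb' hab h₀ hQ hQ',
    fun X hX hX' => integral_mixture ha hb h₀ hX hX'⟩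

end Expectation

end CoherentRisk

namespace CoherentRisk

/-! ### Cash invariance, risk-neutral measures and strong duality. -/

section Duality

variable {Ω : Type*} [MeasurableSpace Ω] {P : Measure Ω}

attribute [local instance] weakTopology

/-! ### Utilities and their determining sets -/

theorem utility_eq_iInf {u : (Ω →ₘ[P] ℝ) → EReal} (hu : IsCoherentUtility u) (X : Ω →ₘ[P] ℝ) :
    u X = ⨅ Q ∈ determiningSet u, expect Q X :=
  (isGreatest_determiningSet hu).1.2 X

theorem determiningSet_nonempty {u : (Ω →ₘ[P] ℝ) → EReal} (hu : IsCoherentUtility u) :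
    (determiningSet u).Nonempty :=
  (isGreatest_determiningSet hu).1.1

theorem IsWeaklyCompact.compactSpace {D : Set (ACProb P)} (hD : IsWeaklyCompact D) :
    CompactSpace D :=
  isCompact_iff_compactSpace.1 hD

/-- A continuous function on a compact set attains its minimum. In particular utilities are finite
on `L_s¹`. -/
theorem exists_utility_eq {u : (Ω →ₘ[P] ℝ) → EReal} (hu : IsCoherentUtility u)
    (hD : IsWeaklyCompact (determiningSet u)) (X : strongL1Submodule (determiningSet u)) :
    ∃ Q, u X = (meanFunctional Q X : EReal) := by
  have := hD.compactSpace
  have : Nonempty (determiningSet u) := (determiningSet_nonempty hu).to_subtype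
  obtain ⟨Q, -, hQ⟩ := isCompact_univ.exists_isMinOn Set.univ_nonempty
    (continuous_meanFunctional X).continuousOn
  have he : ∀ Q : determiningSet u, expect Q.1 X.1 = (meanFunctional Q X : EReal) := fun Q =>
    expect_of_integrable (integrable_of_mem_strongL1 X.2 Q.2)
  refine ⟨Q, le_antisymm ((Q.2 X.1).trans (he Q).le) ?_⟩
  rw [utility_eq_iInf hu]
  refine le_iInf₂ fun Q' hQ' => ?_
  rw [he ⟨Q', hQ'⟩]
  exact EReal.coe_le_coe_iff.2 (hQ (Set.mem_univ (⟨Q', hQ'⟩ : determiningSet u)))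

theorem const_add_const (a b : ℝ) :
    (AEEqFun.const Ω a + AEEqFun.const Ω b : Ω →ₘ[P] ℝ) = AEEqFun.const Ω (a + b) := rfl

theorem utility_add_const_ge {u : (Ω →ₘ[P] ℝ) → EReal} (hu : IsCoherentUtility u)
    (X : Ω →ₘ[P] ℝ) (a : ℝ) : u X + a ≤ u (X + AEEqFun.const Ω a) := by
  rw [utility_eq_iInf hu (X + _)]
  refine le_iInf₂ fun Q hQ => ?_
  rw [add_comm X, expect_add (integrable_coeFn_const Q a), integral_coeFn_const, add_comm]
  gcongr
  exact hQ X

theorem utility_add_const {u : (Ω →ₘ[P] ℝ) → EReal} (hu : IsCoherentUtility u)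
    (X : Ω →ₘ[P] ℝ) (a : ℝ) : u (X + AEEqFun.const Ω a) = u X + a := by
  refine le_antisymm ?_ (utility_add_const_ge hu X a)
  have h := utility_add_const_ge hu (X + AEEqFun.const Ω a) (-a)
  rw [add_assoc, const_add_const, add_neg_cancel,
    show (AEEqFun.const Ω (0 : ℝ) : Ω →ₘ[P] ℝ) = 0 from rfl, add_zero] at h
  calc u (X + AEEqFun.const Ω a) = u (X + AEEqFun.const Ω a) + ((-a : ℝ) : EReal) + a := by
        rw [add_assoc, ← EReal.coe_add, neg_add_cancel, EReal.coe_zero, add_zero]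
    _ ≤ u X + a := by gcongr

theorem pair_add {d : ℕ} (h h' : Fin d → ℝ) (S : Fin d → (Ω →ₘ[P] ℝ)) :
    pair (h + h') S = pair h S + pair h' S := by
  simp only [pair, Pi.add_apply, add_smul, Finset.sum_add_distrib]

theorem pair_smul {d : ℕ} (a : ℝ) (h : Fin d → ℝ) (S : Fin d → (Ω →ₘ[P] ℝ)) :
    pair (a • h) S = a • pair h S := by
  simp only [pair, Pi.smul_apply, smul_eq_mul, mul_smul, Finset.smul_sum]

theorem sum_const {ι : Type*} (s : Finset ι) (f : ι → ℝ) :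
    ∑ i ∈ s, (AEEqFun.const Ω (f i) : Ω →ₘ[P] ℝ) = AEEqFun.const Ω (∑ i ∈ s, f i) :=
  (map_sum (⟨⟨fun a => AEEqFun.const Ω a, rfl⟩, fun _ _ => rfl⟩ : ℝ →+ (Ω →ₘ[P] ℝ)) f s).symm

theorem pair_shift {d : ℕ} (h p : Fin d → ℝ) (S : Fin d → (Ω →ₘ[P] ℝ)) :
    pair h (shift S p) = pair h S + AEEqFun.const Ω (-(h ⬝ᵥ p)) := by
  simp only [pair, shift, smul_sub, Finset.sum_sub_distrib]
  rw [sub_eq_add_neg, show ∀ x : ℝ, (AEEqFun.const Ω (-x) : Ω →ₘ[P] ℝ) = -AEEqFun.const Ω x from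
    fun _ => rfl, dotProduct, ← sum_const]
  rfl

theorem utility_shift {u : (Ω →ₘ[P] ℝ) → EReal} (hu : IsCoherentUtility u) {d : ℕ}
    (Y : Ω →ₘ[P] ℝ) (h p : Fin d → ℝ) (S : Fin d → (Ω →ₘ[P] ℝ)) :
    u (Y + pair h (shift S p)) = u (Y + pair h S) + ((-(h ⬝ᵥ p) : ℝ) : EReal) := by
  rw [pair_shift, ← add_assoc, utility_add_const hu]

theorem utility_eq_shift_add {u : (Ω →ₘ[P] ℝ) → EReal} (hu : IsCoherentUtility u) {d : ℕ}
    (Y : Ω →ₘ[P] ℝ) (h p : Fin d → ℝ) (S : Fin d → (Ω →ₘ[P] ℝ)) :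
    u (Y + pair h S) = u (Y + pair h (shift S p)) + ((h ⬝ᵥ p : ℝ) : EReal) := by
  rw [utility_shift hu, add_assoc, ← EReal.coe_add, neg_add_cancel, EReal.coe_zero, add_zero]

/-! ### Portfolios with payoffs in `L_s¹(D)` -/

/-- The payoff `⟨h, S⟩` as a linear function of `h`. -/
noncomputable def pairLinear {D : Set (ACProb P)} {d : ℕ} (S : Fin d → (Ω →ₘ[P] ℝ))
    (hS : ∀ i, S i ∈ StrongL1 D) : (Fin d → ℝ) →ₗ[ℝ] strongL1Submodule D :=
  Fintype.linearCombination ℝ fun i => ⟨S i, hS i⟩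

theorem coe_pairLinear {D : Set (ACProb P)} {d : ℕ} (S : Fin d → (Ω →ₘ[P] ℝ))
    (hS : ∀ i, S i ∈ StrongL1 D) (h : Fin d → ℝ) : (pairLinear S hS h : Ω →ₘ[P] ℝ) = pair h S := by
  simp [pairLinear, Fintype.linearCombination_apply, pair]

theorem pair_mem_strongL1 {D : Set (ACProb P)} {d : ℕ} {S : Fin d → (Ω →ₘ[P] ℝ)}
    (hS : ∀ i, S i ∈ StrongL1 D) (h : Fin d → ℝ) : pair h S ∈ StrongL1 D :=
  coe_pairLinear S hS h ▸ (pairLinear S hS h).2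

theorem meanFunctional_pairLinear {D : Set (ACProb P)} {d : ℕ} (S : Fin d → (Ω →ₘ[P] ℝ))
    (hS : ∀ i, S i ∈ StrongL1 D) (Q : D) (h : Fin d → ℝ) :
    meanFunctional Q (pairLinear S hS h) = h ⬝ᵥ meanVec Q.1 S := by
  rw [pairLinear, Fintype.linearCombination_apply, map_sum]
  simp only [map_smul, smul_eq_mul]
  rfl

theorem integral_pair {D : Set (ACProb P)} {d : ℕ} {S : Fin d → (Ω →ₘ[P] ℝ)}
    (hS : ∀ i, S i ∈ StrongL1 D) {Q : ACProb P} (hQ : Q ∈ D) (h : Fin d → ℝ) :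
    ∫ ω, pair h S ω ∂Q.1 = h ⬝ᵥ meanVec Q S := by
  rw [← meanFunctional_pairLinear S hS ⟨Q, hQ⟩ h, meanFunctional_apply, coe_pairLinear]

theorem shift_mem_strongL1 {D : Set (ACProb P)} {d : ℕ} {S : Fin d → (Ω →ₘ[P] ℝ)}
    (hS : ∀ i, S i ∈ StrongL1 D) (p : Fin d → ℝ) (i : Fin d) : shift S p i ∈ StrongL1 D :=
  (strongL1Submodule D).sub_mem (hS i) (const_mem_strongL1 D (p i))

theorem meanVec_shift {D : Set (ACProb P)} {d : ℕ} {S : Fin d → (Ω →ₘ[P] ℝ)}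
    (hS : ∀ i, S i ∈ StrongL1 D) (p : Fin d → ℝ) {Q : ACProb P} (hQ : Q ∈ D) :
    meanVec Q (shift S p) = meanVec Q S - p := by
  funext i
  have h := map_sub (meanFunctional ⟨Q, hQ⟩) ⟨S i, hS i⟩ ⟨_, const_mem_strongL1 D (p i)⟩
  simp only [meanFunctional_apply] at h
  rw [integral_coeFn_const] at h
  exact h

theorem continuous_meanVec {D : Set (ACProb P)} {d : ℕ} {S : Fin d → (Ω →ₘ[P] ℝ)}
    (hS : ∀ i, S i ∈ StrongL1 D) : Continuous fun Q : D => meanVec Q.1 S :=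
  continuous_pi fun i => continuous_meanFunctional ⟨S i, hS i⟩

/-! ### Risk-neutral measures -/

/-- This is where consistency enters: the constraints from `A ∩ L_s¹(D)` include those from `A'`,
which already imply all the others. Risk neutrality thus becomes a family of weakly closed
conditions. -/
theorem mem_riskNeutral_iff {D : Set (ACProb P)} {A : Set (Ω →ₘ[P] ℝ)} (hA : IsConsistent D A)
    {Q : ACProb P} (hQ : Q ∈ D) :
    Q ∈ riskNeutral A ↔ ∀ X ∈ A, X ∈ StrongL1 D → ∫ ω, X ω ∂Q.1 ≤ 0 := by
  constructor
  · intro h X hX hX'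
    have := h X hX
    rw [expect_of_integrable (integrable_of_mem_strongL1 hX' hQ)] at this
    exact_mod_cast this
  · obtain ⟨A', hA', he⟩ := hA
    intro h
    have hQ' : Q ∈ D ∩ riskNeutral A' := ⟨hQ, fun X hX => by
      rw [expect_of_integrable (integrable_of_mem_strongL1 (hA' hX).2 hQ)]
      exact_mod_cast h X (hA' hX).1 (hA' hX).2⟩
    exact (he ▸ hQ').2

theorem isCompact_riskNeutral {D : Set (ACProb P)} {A : Set (Ω →ₘ[P] ℝ)} (hD : IsWeaklyCompact D)
    (hA : IsConsistent D A) : IsCompact {Q : D | Q.1 ∈ riskNeutral A} := by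
  have := hD.compactSpace
  refine IsClosed.isCompact ?_
  have he : {Q : D | Q.1 ∈ riskNeutral A} = ⋂ X : {X : strongL1Submodule D // X.1 ∈ A},
      {Q | meanFunctional Q X.1 ≤ 0} := by
    ext Q
    rw [Set.mem_iInter]
    exact (mem_riskNeutral_iff hA Q.2).trans
      ⟨fun h X => h X.1.1 X.2 X.1.2, fun h X hX hX' => h ⟨⟨X, hX'⟩, hX⟩⟩
  rw [he]
  exact isClosed_iInter fun X => isClosed_le (continuous_meanFunctional _) continuous_const

/-- The image is compact, so the closures in `G n` and `G̃ n` add nothing and their points come from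
actual measures. -/
theorem closure_image_riskNeutral {D : Set (ACProb P)} {A : Set (Ω →ₘ[P] ℝ)}
    (hD : IsWeaklyCompact D) (hA : IsConsistent D A) {E : Type*} [TopologicalSpace E] [T2Space E]
    {f : ACProb P → E} (hf : Continuous fun Q : D => f Q.1) :
    closure (f '' (D ∩ riskNeutral A)) = f '' (D ∩ riskNeutral A) := by
  have he : f '' (D ∩ riskNeutral A) = (fun Q : D => f Q.1) '' {Q : D | Q.1 ∈ riskNeutral A} := by
    ext x
    constructor
    · rintro ⟨Q, ⟨hQ, hQ'⟩, rfl⟩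
      exact ⟨⟨Q, hQ⟩, hQ', rfl⟩
    · rintro ⟨Q, hQ, rfl⟩
      exact ⟨Q.1, ⟨Q.2, hQ⟩, rfl⟩
  rw [he]
  exact ((isCompact_riskNeutral hD hA).image hf).isClosed.closure_eq

theorem expect_le_of_riskNeutral {D : Set (ACProb P)} {A : Set (Ω →ₘ[P] ℝ)}
    {W : Ω →ₘ[P] ℝ} (hW : W ∈ StrongL1 D) {d : ℕ} {S : Fin d → (Ω →ₘ[P] ℝ)}
    (hS : ∀ i, S i ∈ StrongL1 D) {Q : ACProb P} (hQ : Q ∈ D)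
    (hQA : Q ∈ riskNeutral A) {ξ : Ω →ₘ[P] ℝ} (hξ : ξ ∈ A) (η : Fin d → ℝ) :
    expect Q (W + ξ + pair η S) ≤ ((∫ ω, W ω ∂Q.1 + η ⬝ᵥ meanVec Q S : ℝ) : EReal) := by
  have hWi := integrable_of_mem_strongL1 hW hQ
  have hpi := integrable_of_mem_strongL1 (pair_mem_strongL1 hS η) hQ
  calc expect Q (W + ξ + pair η S) = expect Q ((W + pair η S) + ξ) := by rw [add_right_comm]
    _ = ((∫ ω, W ω ∂Q.1 + η ⬝ᵥ meanVec Q S : ℝ) : EReal) + expect Q ξ := by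
        rw [expect_add (integrable_coeFn_add hWi hpi), integral_coeFn_add hWi hpi,
          integral_pair hS hQ]
    _ ≤ _ := by
        refine (add_le_add le_rfl (hQA ξ hξ)).trans (le_of_eq ?_)
        rw [add_zero]

/-! ### Strong duality -/

/-- Each utility is a minimum over its determining set, so the bound `m` on the primal values
supplies, for each `c`, a tuple of measures that makes the penalized objective at most `m`.
`exists_feasible_le` on the compact product of the determining sets then selects one tuple for all
`c`. The abstract `V` and `Z` cover both a single agent and the whole market. -/
theorem exists_feasible_measures {ι : Type*} [Fintype ι] {u : ι → (Ω →ₘ[P] ℝ) → EReal}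
    (hu : ∀ i, IsCoherentUtility (u i)) (hD : ∀ i, IsWeaklyCompact (determiningSet (u i)))
    (W : ∀ i, strongL1Submodule (determiningSet (u i))) {V : Type*} [AddCommGroup V] [Module ℝ V]
    (Z : ∀ i, V →ₗ[ℝ] strongL1Submodule (determiningSet (u i))) (C : PointedCone ℝ V) {m : ℝ}
    (h : ∀ c ∈ C, ∑ i, u i (W i + Z i c : Ω →ₘ[P] ℝ) ≤ m) :
    ∃ Q : ∀ i, determiningSet (u i), ∑ i, meanFunctional (Q i) (W i) ≤ m ∧
      ∀ c ∈ C, ∑ i, meanFunctional (Q i) (Z i c) ≤ 0 := by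
  have hcpt : ∀ i, CompactSpace (determiningSet (u i)) := fun i => (hD i).compactSpace
  have hne : ∀ i, Nonempty (determiningSet (u i)) := fun i =>
    (determiningSet_nonempty (hu i)).to_subtype
  obtain ⟨Q, hQ, hQ'⟩ := exists_feasible_le C
    (fun Q : ∀ i, determiningSet (u i) => ∑ i, meanFunctional (Q i) (W i))
    (fun Q => ∑ i, meanFunctional (Q i) ∘ₗ Z i)
    (continuous_finsetSum _ fun i _ => (continuous_meanFunctional (W i)).comp (continuous_apply i))
    (fun c => by
      simp only [LinearMap.sum_apply, LinearMap.comp_apply]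
      exact continuous_finsetSum _ fun i _ =>
        (continuous_meanFunctional (Z i c)).comp (continuous_apply i))
    (fun Q Q' a b ha hb hab => by
      choose R hR hR' using fun i =>
        exists_mem_determiningSet_integral_eq (Q i).2 (Q' i).2 ha hb hab
      have hmix : ∀ i (X : strongL1Submodule (determiningSet (u i))),
          meanFunctional ⟨R i, hR i⟩ X = a * meanFunctional (Q i) X + b * meanFunctional (Q' i) X :=
        fun i X => hR' i X.1 (integrable_of_mem_strongL1 X.2 (Q i).2)
          (integrable_of_mem_strongL1 X.2 (Q' i).2)
      refine ⟨fun i => ⟨R i, hR i⟩, ?_, fun c => ?_⟩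
      · simp only [hmix, Finset.sum_add_distrib, Finset.mul_sum]
      · simp only [LinearMap.sum_apply, LinearMap.comp_apply, hmix, Finset.sum_add_distrib,
          Finset.mul_sum])
    (m := m) (fun c hc => by
      choose Q hQ using fun i => exists_utility_eq (hu i) (hD i) (W i + Z i c)
      refine ⟨Q, ?_⟩
      have hm := h c hc
      have he : ∑ i, u i (W i + Z i c : Ω →ₘ[P] ℝ) =
          ((∑ i, meanFunctional (Q i) (W i + Z i c) : ℝ) : EReal) := by
        rw [EReal.coe_sum]
        exact Finset.sum_congr rfl fun i _ => hQ i
      rw [he, EReal.coe_le_coe_iff] at hm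
      simpa only [LinearMap.sum_apply, LinearMap.comp_apply, map_add, Finset.sum_add_distrib]
        using hm)
  exact ⟨Q, hQ, fun c hc => by simpa using hQ' c hc⟩

theorem eq_of_forall_dotProduct_sub_nonpos {d : ℕ} {x y : Fin d → ℝ}
    (h : ∀ v : Fin d → ℝ, v ⬝ᵥ (x - y) ≤ 0) : x = y :=
  sub_eq_zero.1 (dotProduct_self_eq_zero.1
    (le_antisymm (h (x - y)) (Finset.sum_nonneg fun _ _ => mul_self_nonneg _)))

/-- Strong duality for a single agent who trades contracts at the price vector `p`. -/
theorem exists_pricing_of_utility_le {u : (Ω →ₘ[P] ℝ) → EReal} (hu : IsCoherentUtility u)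
    (hD : IsWeaklyCompact (determiningSet u)) {A : PointedCone ℝ (Ω →ₘ[P] ℝ)}
    (hA : IsConsistent (determiningSet u) (A : Set (Ω →ₘ[P] ℝ))) {W : Ω →ₘ[P] ℝ}
    (hW : W ∈ StrongL1 (determiningSet u)) {d : ℕ} {S : Fin d → (Ω →ₘ[P] ℝ)}
    (hS : ∀ i, S i ∈ StrongL1 (determiningSet u)) {p : Fin d → ℝ} {m : ℝ}
    (h : ∀ ξ ∈ A, ∀ η, u (W + ξ + pair η (shift S p)) ≤ m) :
    ∃ Q ∈ determiningSet u ∩ riskNeutral (A : Set (Ω →ₘ[P] ℝ)),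
      meanVec Q S = p ∧ ∫ ω, W ω ∂Q.1 ≤ m := by
  have hSp := shift_mem_strongL1 hS p
  -- The cone consists of pairs `(ξ, η)` with `ξ ∈ A` in `L_s¹` and `η` free. Directions `ξ` yield
  -- risk neutrality; free directions `η` force `E_Q (S - p) = 0`.
  obtain ⟨Q, hQ, hQ'⟩ := exists_feasible_measures (ι := Unit) (fun _ => hu) (fun _ => hD)
    (fun _ => ⟨W, hW⟩) (V := strongL1Submodule (determiningSet u) × (Fin d → ℝ))
    (fun _ => LinearMap.coprod LinearMap.id (pairLinear (shift S p) hSp))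
    (PointedCone.comap ((strongL1Submodule (determiningSet u)).subtype ∘ₗ LinearMap.fst ℝ _ _) A)
    (m := m) (fun c hc => by
      have := h c.1 hc c.2
      simp only [Finset.univ_unique, Finset.sum_singleton, LinearMap.coprod_apply,
        LinearMap.id_apply, Submodule.coe_add, coe_pairLinear]
      rwa [← add_assoc])
  simp only [Finset.univ_unique, Finset.sum_singleton, LinearMap.coprod_apply,
    LinearMap.id_apply, map_add, meanFunctional_pairLinear] at hQ hQ'
  have hQD := (Q default).2
  refine ⟨(Q default).1, ⟨hQD, ?_⟩, ?_, hQ⟩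
  · refine (mem_riskNeutral_iff hA hQD).2 fun X hX hX' => ?_
    simpa [meanFunctional_apply] using hQ' (⟨X, hX'⟩, 0) hX
  · refine eq_of_forall_dotProduct_sub_nonpos fun v => ?_
    have := hQ' (0, v) A.zero_mem
    simpa [meanVec_shift hS p hQD] using this

end Duality

end CoherentRisk

namespace CoherentRisk

/-! ### The market: duality, equilibria and Pareto dominance. -/

section Agents

variable {Ω : Type*} [MeasurableSpace Ω] {P : Measure Ω} {N d : ℕ}
  {u : Fin N → (Ω →ₘ[P] ℝ) → EReal} {A : Fin N → PointedCone ℝ (Ω →ₘ[P] ℝ)}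
  {W : Fin N → (Ω →ₘ[P] ℝ)} {S : Fin d → (Ω →ₘ[P] ℝ)}

attribute [local instance] weakTopology

/-- The allocations whose P&Ls lie in `L_s¹(D n)`, as a convex cone. -/
def allocationCone (A : Fin N → PointedCone ℝ (Ω →ₘ[P] ℝ)) (D : Fin N → Set (ACProb P)) (d : ℕ) :
    PointedCone ℝ ((∀ n, strongL1Submodule (D n)) × (Fin N → Fin d → ℝ)) where
  carrier := {c | (∀ n, (c.1 n : Ω →ₘ[P] ℝ) ∈ A n) ∧ ∑ n, c.2 n = 0}
  add_mem' := fun {c c'} hc hc' => ⟨fun n => (A n).add_mem (hc.1 n) (hc'.1 n), by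
    simp [Finset.sum_add_distrib, hc.2, hc'.2]⟩
  zero_mem' := ⟨fun n => (A n).zero_mem, by simp⟩
  smul_mem' := fun a c hc => ⟨fun n => (A n).smul_mem a.2 (hc.1 n), by
    simp [← Finset.smul_sum, hc.2]⟩

/-- The test exchange hands `v` to agent `n` and `-v` to agent `m`. -/
theorem eq_of_forall_sum_dotProduct_nonpos {x : Fin N → Fin d → ℝ}
    (h : ∀ η : Fin N → Fin d → ℝ, ∑ n, η n = 0 → ∑ n, η n ⬝ᵥ x n ≤ 0) (n m : Fin N) :
    x n = x m := by
  refine eq_of_forall_dotProduct_sub_nonpos fun v => ?_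
  have hs : ∀ k (f : Fin N → Fin d → ℝ),
      ∑ i, (Pi.single k v : Fin N → Fin d → ℝ) i ⬝ᵥ f i = v ⬝ᵥ f k := fun k f => by
    rw [Finset.sum_eq_single k (fun i _ hi => by rw [Pi.single_eq_of_ne hi, zero_dotProduct])
      (fun hk => (hk (Finset.mem_univ k)).elim), Pi.single_eq_same]
  have := h (Pi.single n v - Pi.single m v) (by simp [Finset.sum_sub_distrib])
  simpa only [Pi.sub_apply, sub_dotProduct, Finset.sum_sub_distrib, hs, ← dotProduct_sub]
    using this

/-- Strong duality for the overall utility. -/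
theorem exists_common_pricing (hu : ∀ n, IsCoherentUtility (u n))
    (hD : ∀ n, IsWeaklyCompact (determiningSet (u n)))
    (hA : ∀ n, IsConsistent (determiningSet (u n)) (A n : Set (Ω →ₘ[P] ℝ)))
    (hW : ∀ n, W n ∈ StrongL1 (determiningSet (u n)))
    (hS : ∀ i n, S i ∈ StrongL1 (determiningSet (u n))) {m : ℝ}
    (h : ∀ X η, IsAllocation A X η → overallUtility u W S X η ≤ m) :
    ∃ (Q : Fin N → ACProb P) (p : Fin d → ℝ), (∀ n, Q n ∈ pricingMeasures u A n) ∧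
      (∀ n, meanVec (Q n) S = p) ∧ ∑ n, ∫ ω, W n ω ∂(Q n).1 ≤ m := by
  obtain ⟨Q, hQ, hQ'⟩ := exists_feasible_measures hu hD (fun n => ⟨W n, hW n⟩)
    (V := (∀ n, strongL1Submodule (determiningSet (u n))) × (Fin N → Fin d → ℝ))
    (fun n => LinearMap.coprod (LinearMap.proj n)
      (pairLinear S (fun i => hS i n) ∘ₗ LinearMap.proj n))
    (allocationCone A (fun n => determiningSet (u n)) d) (m := m) (fun c hc => by
      refine le_trans (le_of_eq (Finset.sum_congr rfl fun n _ => ?_))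
        (h (fun n => c.1 n) c.2 hc)
      simp only [LinearMap.coprod_apply, LinearMap.comp_apply, LinearMap.proj_apply,
        Submodule.coe_add, coe_pairLinear]
      rw [← add_assoc])
  simp only [LinearMap.coprod_apply, LinearMap.comp_apply, LinearMap.proj_apply, map_add,
    meanFunctional_pairLinear] at hQ'
  have hp : ∃ p, ∀ n, meanVec (Q n).1 S = p := by
    have heq := eq_of_forall_sum_dotProduct_nonpos (x := fun n => meanVec (Q n).1 S)
      fun η hη => by simpa using hQ' (0, η) ⟨fun n => (A n).zero_mem, hη⟩
    -- Without agents any price serves.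
    rcases isEmpty_or_nonempty (Fin N) with hN | ⟨⟨k⟩⟩
    · exact ⟨0, fun n => hN.elim n⟩
    · exact ⟨_, fun n => heq n k⟩
  obtain ⟨p, hp⟩ := hp
  refine ⟨fun n => (Q n).1, p, fun n => ⟨(Q n).2, ?_⟩, hp, hQ⟩
  refine (mem_riskNeutral_iff (hA n) (Q n).2).2 fun X hX hX' => ?_
  -- Only agent `n` acts, with P&L `X`, and no contracts are exchanged.
  have := hQ' (Pi.single n ⟨X, hX'⟩, 0) ⟨fun k => ?_, by simp⟩
  · simp only [Pi.zero_apply, zero_dotProduct, add_zero] at this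
    rw [Finset.sum_eq_single n (fun k _ hk => by rw [Pi.single_eq_of_ne hk, map_zero])
      (fun hk => (hk (Finset.mem_univ n)).elim), Pi.single_eq_same] at this
    exact this
  · rcases eq_or_ne k n with rfl | hk
    · simpa using hX
    · simp [Pi.single_eq_of_ne hk]

/-! ### Weak duality -/

theorem agentFun_le {n : Fin N} {Q : ACProb P} (hQ : Q ∈ pricingMeasures u A n) :
    agentFun u A W S n (meanVec Q S) ≤ ((∫ ω, W n ω ∂Q.1 : ℝ) : EReal) := by
  have h : (meanVec Q S, ∫ ω, W n ω ∂Q.1) ∈ agentGenExt u A W S n :=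
    subset_closure (Set.mem_image_of_mem (fun Q => (meanVec Q S, ∫ ω, W n ω ∂Q.1)) hQ)
  exact iInf₂_le (f := fun (y : ℝ) (_ : (meanVec Q S, y) ∈ agentGenExt u A W S n) => (y : EReal))
    _ h

/-- Each `(p, y) ∈ G̃ n` is `E_Q (S, W n)` for a risk-neutral `Q` of the determining set. Under `Q`
the trade at price `p` costs its mean payoff and `ξ` adds at most zero, so only `E_Q W n = y`
remains. -/
theorem utility_shift_le_agentFun {n : Fin N} (hu : IsCoherentUtility (u n))
    (hD : IsWeaklyCompact (determiningSet (u n)))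
    (hA : IsConsistent (determiningSet (u n)) (A n : Set (Ω →ₘ[P] ℝ)))
    (hW : W n ∈ StrongL1 (determiningSet (u n)))
    (hS : ∀ i, S i ∈ StrongL1 (determiningSet (u n))) {ξ : Ω →ₘ[P] ℝ} (hξ : ξ ∈ A n)
    (η p : Fin d → ℝ) :
    u n (W n + ξ + pair η (shift S p)) ≤ agentFun u A W S n p := by
  refine le_iInf₂ fun y hy => ?_
  rw [agentGenExt, pricingMeasures, closure_image_riskNeutral hD hA
    ((continuous_meanVec hS).prodMk (continuous_meanFunctional ⟨W n, hW⟩))] at hy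
  obtain ⟨Q, ⟨hQ, hQA⟩, he⟩ := hy
  obtain ⟨rfl, rfl⟩ := Prod.mk.inj he
  rw [utility_shift hu]
  refine (add_le_add_left ((hQ _).trans (expect_le_of_riskNeutral hW hS hQ hQA hξ η)) _).trans
    (le_of_eq ?_)
  rw [← EReal.coe_add, add_neg_cancel_right]

theorem mem_gen_iff (hD : ∀ n, IsWeaklyCompact (determiningSet (u n)))
    (hA : ∀ n, IsConsistent (determiningSet (u n)) (A n : Set (Ω →ₘ[P] ℝ)))
    (hS : ∀ i n, S i ∈ StrongL1 (determiningSet (u n))) {p : Fin d → ℝ} :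
    p ∈ gen u A S ↔ ∀ n, ∃ Q ∈ pricingMeasures u A n, meanVec Q S = p := by
  rw [gen, Set.mem_iInter]
  refine forall_congr' fun n => ?_
  rw [agentGen, pricingMeasures, closure_image_riskNeutral (hD n) (hA n)
    (continuous_meanVec fun i => hS i n)]
  rfl

theorem overallUtility_eq_sum_shift (hu : ∀ n, IsCoherentUtility (u n))
    {X : Fin N → (Ω →ₘ[P] ℝ)} {h : Fin N → Fin d → ℝ} (hh : ∑ n, h n = 0) (p : Fin d → ℝ) :
    overallUtility u W S X h = ∑ n, u n (W n + X n + pair (h n) (shift S p)) := by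
  simp only [overallUtility, utility_eq_shift_add (hu _) _ (h _) p S]
  rw [EReal.sum_add_coe, ← sum_dotProduct, hh, zero_dotProduct, EReal.coe_zero, add_zero]

theorem overallUtility_le_max {X : Fin N → (Ω →ₘ[P] ℝ)} {h : Fin N → Fin d → ℝ}
    (ha : IsAllocation A X h) : overallUtility u W S X h ≤ maxOverallUtility u A W S :=
  le_iSup_of_le X (le_iSup₂_of_le h ha le_rfl)

theorem maxOverallUtility_le_sum_agentFun (hu : ∀ n, IsCoherentUtility (u n))
    (hD : ∀ n, IsWeaklyCompact (determiningSet (u n)))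
    (hA : ∀ n, IsConsistent (determiningSet (u n)) (A n : Set (Ω →ₘ[P] ℝ)))
    (hW : ∀ n, W n ∈ StrongL1 (determiningSet (u n)))
    (hS : ∀ i n, S i ∈ StrongL1 (determiningSet (u n))) (p : Fin d → ℝ) :
    maxOverallUtility u A W S ≤ ∑ n, agentFun u A W S n p := by
  refine iSup_le fun X => iSup₂_le fun h ha => ?_
  rw [overallUtility_eq_sum_shift hu ha.2 p]
  exact Finset.sum_le_sum fun n _ =>
    utility_shift_le_agentFun (hu n) (hD n) (hA n) (hW n) (fun i => hS i n) (ha.1 n) _ _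

/-- The zero allocation yields `∑ u n (W n)`, which is finite. -/
theorem maxOverallUtility_ne_bot (hu : ∀ n, IsCoherentUtility (u n))
    (hD : ∀ n, IsWeaklyCompact (determiningSet (u n)))
    (hW : ∀ n, W n ∈ StrongL1 (determiningSet (u n))) :
    maxOverallUtility u A W S ≠ ⊥ := by
  have h := overallUtility_le_max (u := u) (A := A) (W := W) (S := S) (X := 0) (h := 0)
    ⟨fun n => (A n).zero_mem, by simp⟩
  refine ne_bot_of_le_ne_bot (EReal.sum_ne_bot _ fun n => ?_) h
  obtain ⟨Q, hQ⟩ := exists_utility_eq (hu n) (hD n) ⟨W n, hW n⟩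
  have he : W n + (0 : Fin N → (Ω →ₘ[P] ℝ)) n + pair ((0 : Fin N → Fin d → ℝ) n) S = W n := by
    simp [pair]
  rw [he, hQ]
  exact EReal.coe_ne_bot _

/-- Dual attainment: together with weak duality, this `p` minimizes `∑ f_n` and the minimum is `M`.
-/
theorem exists_mem_gen_sum_agentFun_le (hu : ∀ n, IsCoherentUtility (u n))
    (hD : ∀ n, IsWeaklyCompact (determiningSet (u n)))
    (hA : ∀ n, IsConsistent (determiningSet (u n)) (A n : Set (Ω →ₘ[P] ℝ)))
    (hW : ∀ n, W n ∈ StrongL1 (determiningSet (u n)))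
    (hS : ∀ i n, S i ∈ StrongL1 (determiningSet (u n)))
    (hM : maxOverallUtility u A W S < ⊤) :
    ∃ p ∈ gen u A S, ∑ n, agentFun u A W S n p ≤ maxOverallUtility u A W S := by
  have hM' := maxOverallUtility_ne_bot (A := A) (S := S) hu hD hW
  have he := EReal.coe_toReal hM.ne hM'
  obtain ⟨Q, p, hQ, hp, hle⟩ := exists_common_pricing hu hD hA hW hS
    (m := (maxOverallUtility u A W S).toReal) fun X η ha => by
      rw [he]
      exact overallUtility_le_max ha
  refine ⟨p, (mem_gen_iff hD hA hS).2 fun n => ⟨Q n, hQ n, hp n⟩, ?_⟩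
  rw [← he]
  refine le_trans ?_ (EReal.coe_le_coe_iff.2 hle)
  rw [EReal.coe_sum]
  exact Finset.sum_le_sum fun n _ => hp n ▸ agentFun_le (hQ n)

theorem maxOverallUtility_lt_top_iff (hu : ∀ n, IsCoherentUtility (u n))
    (hD : ∀ n, IsWeaklyCompact (determiningSet (u n)))
    (hA : ∀ n, IsConsistent (determiningSet (u n)) (A n : Set (Ω →ₘ[P] ℝ)))
    (hW : ∀ n, W n ∈ StrongL1 (determiningSet (u n)))
    (hS : ∀ i n, S i ∈ StrongL1 (determiningSet (u n))) :
    maxOverallUtility u A W S < ⊤ ↔ (gen u A S).Nonempty := by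
  refine ⟨fun hM => ?_, fun ⟨p, hp⟩ => ?_⟩
  · obtain ⟨p, hp, -⟩ := exists_mem_gen_sum_agentFun_le hu hD hA hW hS hM
    exact ⟨p, hp⟩
  · choose Q hQ hQp using (mem_gen_iff hD hA hS).1 hp
    refine ((maxOverallUtility_le_sum_agentFun hu hD hA hW hS p).trans
      (Finset.sum_le_sum fun n _ => (hQp n ▸ agentFun_le (hQ n) :
        agentFun u A W S n p ≤ ((∫ ω, W n ω ∂(Q n).1 : ℝ) : EReal)))).trans_lt ?_
    rw [← EReal.coe_sum]
    exact EReal.coe_lt_top _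

/-! ### Equilibria -/

variable {X : Fin N → (Ω →ₘ[P] ℝ)} {h : Fin N → Fin d → ℝ} {p : Fin d → ℝ}

theorem IsArrowDebreuEquilibrium.isParetoEquilibrium (hu : ∀ n, IsCoherentUtility (u n))
    (hp : IsArrowDebreuEquilibrium u A W S X h p) : IsParetoEquilibrium u A W S X h := by
  refine ⟨hp.1, le_antisymm (overallUtility_le_max hp.1) ?_⟩
  refine iSup_le fun X' => iSup₂_le fun h' ha' => ?_
  rw [overallUtility_eq_sum_shift hu ha'.2 p, overallUtility_eq_sum_shift hu hp.1.2 p]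
  exact Finset.sum_le_sum fun n _ => hp.2 n _ (ha'.1 n) _

/-- The utilities at price `p` are at most `f_n(p)`, while their sum is `M ≥ ∑ f_n(p)`. As `M` is
finite, equality holds agent by agent, and `f_n(p)` bounds every competing trade. -/
theorem IsParetoEquilibrium.isArrowDebreuEquilibrium (hu : ∀ n, IsCoherentUtility (u n))
    (hD : ∀ n, IsWeaklyCompact (determiningSet (u n)))
    (hA : ∀ n, IsConsistent (determiningSet (u n)) (A n : Set (Ω →ₘ[P] ℝ)))
    (hW : ∀ n, W n ∈ StrongL1 (determiningSet (u n)))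
    (hS : ∀ i n, S i ∈ StrongL1 (determiningSet (u n)))
    (hM : maxOverallUtility u A W S < ⊤) (hX : IsParetoEquilibrium u A W S X h)
    (hp : ∑ n, agentFun u A W S n p ≤ maxOverallUtility u A W S) :
    IsArrowDebreuEquilibrium u A W S X h p := by
  have hM' := maxOverallUtility_ne_bot (A := A) (S := S) hu hD hW
  have hweak : ∀ n, ∀ ξ ∈ A n, ∀ η, u n (W n + ξ + pair η (shift S p)) ≤ agentFun u A W S n p :=
    fun n ξ hξ η =>
      utility_shift_le_agentFun (hu n) (hD n) (hA n) (hW n) (fun i => hS i n) hξ η p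
  have hsum := hX.2
  rw [overallUtility_eq_sum_shift hu hX.1.2 p] at hsum
  have heq := EReal.eq_of_le_of_sum_le (fun n => hweak n _ (hX.1.1 n) (h n))
    (hsum ▸ hp) (hsum ▸ hM') (hsum ▸ hM.ne)
  refine ⟨hX.1, fun n ξ hξ η => ?_⟩
  rw [heq n]
  exact hweak n ξ hξ η

/-- Finiteness of `M` makes each agent's optimal value real, so that single-agent duality applies
with `m` equal to that value. -/
theorem IsArrowDebreuEquilibrium.exists_pricing (hu : ∀ n, IsCoherentUtility (u n))
    (hD : ∀ n, IsWeaklyCompact (determiningSet (u n)))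
    (hA : ∀ n, IsConsistent (determiningSet (u n)) (A n : Set (Ω →ₘ[P] ℝ)))
    (hW : ∀ n, W n ∈ StrongL1 (determiningSet (u n)))
    (hS : ∀ i n, S i ∈ StrongL1 (determiningSet (u n)))
    (hM : maxOverallUtility u A W S < ⊤) (hp : IsArrowDebreuEquilibrium u A W S X h p)
    (n : Fin N) :
    ∃ Q ∈ pricingMeasures u A n, meanVec Q S = p ∧
      ((∫ ω, W n ω ∂Q.1 : ℝ) : EReal) ≤ u n (W n + X n + pair (h n) (shift S p)) ∧
      u n (W n + X n + pair (h n) (shift S p)) ≠ ⊥ ∧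
      u n (W n + X n + pair (h n) (shift S p)) ≠ ⊤ := by
  have hM' := maxOverallUtility_ne_bot (A := A) (S := S) hu hD hW
  have hsum := (hp.isParetoEquilibrium hu).2
  rw [overallUtility_eq_sum_shift hu hp.1.2 p] at hsum
  have hbot := EReal.ne_bot_of_sum_ne_bot (hsum ▸ hM')
  have htop := EReal.ne_top_of_sum_ne_top hbot (hsum ▸ hM.ne) n
  have he := EReal.coe_toReal htop (hbot n)
  obtain ⟨Q, hQ, hQp, hle⟩ := exists_pricing_of_utility_le (hu n) (hD n) (hA n) (hW n)
    (fun i => hS i n) (p := p) (m := (u n (W n + X n + pair (h n) (shift S p))).toReal)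
    fun ξ hξ η => by
      rw [he]
      exact hp.2 n ξ hξ η
  refine ⟨Q, hQ, hQp, ?_, hbot n, htop⟩
  rw [← he]
  exact EReal.coe_le_coe_iff.2 hle

theorem equilibriumPrices_eq_argminPrices (hu : ∀ n, IsCoherentUtility (u n))
    (hD : ∀ n, IsWeaklyCompact (determiningSet (u n)))
    (hA : ∀ n, IsConsistent (determiningSet (u n)) (A n : Set (Ω →ₘ[P] ℝ)))
    (hW : ∀ n, W n ∈ StrongL1 (determiningSet (u n)))
    (hS : ∀ i n, S i ∈ StrongL1 (determiningSet (u n)))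
    (hM : maxOverallUtility u A W S < ⊤) (hX : IsParetoEquilibrium u A W S X h) :
    equilibriumPrices u A W S X h = argminPrices u A W S := by
  ext p
  constructor
  · intro hp
    choose Q hQ hQp hle _ using hp.exists_pricing hu hD hA hW hS hM
    refine ⟨(mem_gen_iff hD hA hS).2 fun n => ⟨Q n, hQ n, hQp n⟩, fun y _ => ?_⟩
    refine le_trans ?_ (maxOverallUtility_le_sum_agentFun hu hD hA hW hS y)
    rw [← hX.2, overallUtility_eq_sum_shift hu hX.1.2 p]
    exact Finset.sum_le_sum fun n _ => le_trans (hQp n ▸ agentFun_le (hQ n)) (hle n)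
  · intro hp
    obtain ⟨p', hp', hle⟩ := exists_mem_gen_sum_agentFun_le hu hD hA hW hS hM
    exact hX.isArrowDebreuEquilibrium hu hD hA hW hS hM ((hp.2 p' hp').trans hle)

/-- The pricing measure of the agent is extreme: with `Y = W n + X n + ⟨h n, S⟩`, one has `E_Q Y ≤
E_Q W n + ⟨h n, p⟩ ≤ u n Y ≤ E_Q Y`. -/
theorem equilibriumPrices_subset_dualPrices (hu : ∀ n, IsCoherentUtility (u n))
    (hD : ∀ n, IsWeaklyCompact (determiningSet (u n)))
    (hA : ∀ n, IsConsistent (determiningSet (u n)) (A n : Set (Ω →ₘ[P] ℝ)))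
    (hW : ∀ n, W n ∈ StrongL1 (determiningSet (u n)))
    (hS : ∀ i n, S i ∈ StrongL1 (determiningSet (u n)))
    (hM : maxOverallUtility u A W S < ⊤) :
    equilibriumPrices u A W S X h ⊆ dualPrices u A W S X h := by
  intro p hp
  refine Set.mem_iInter.2 fun n => ?_
  obtain ⟨Q, hQ, hQp, hle, hbot, htop⟩ := hp.exists_pricing hu hD hA hW hS hM n
  have he : expect Q (W n + X n + pair (h n) S) = u n (W n + X n + pair (h n) S) := by
    refine le_antisymm ?_ (hQ.1 _)
    refine (expect_le_of_riskNeutral (hW n) (fun i => hS i n) hQ.1 hQ.2 (hp.1.1 n) _).trans ?_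
    rw [utility_eq_shift_add (hu n) _ (h n) p S, hQp, EReal.coe_add]
    gcongr
  refine ⟨Q, ⟨⟨hQ.1, by rw [he, utility_eq_iInf (hu n)], ?_, ?_⟩, hQ.2⟩, hQp⟩
  · rw [he, utility_eq_shift_add (hu n) _ (h n) p S, Ne, EReal.add_eq_bot_iff]
    simp [hbot]
  · rw [he, utility_eq_shift_add (hu n) _ (h n) p S]
    exact EReal.add_ne_top htop (EReal.coe_ne_top _)

theorem dualPrices_subset_equilibriumPrices (hu : ∀ n, IsCoherentUtility (u n))
    (hW : ∀ n, W n ∈ StrongL1 (determiningSet (u n)))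
    (hS : ∀ i n, S i ∈ StrongL1 (determiningSet (u n)))
    (hlin : ∀ n, IsLinear (A n : Set (Ω →ₘ[P] ℝ))) (ha : IsAllocation A X h) :
    dualPrices u A W S X h ⊆ equilibriumPrices u A W S X h := by
  intro p hp
  refine ⟨ha, fun n ξ hξ η => ?_⟩
  obtain ⟨Q, ⟨⟨hQ, hext, hbot, htop⟩, hQA⟩, rfl⟩ := Set.mem_iInter.1 hp n
  have hWi := integrable_of_mem_strongL1 (hW n) hQ
  have hpi := integrable_of_mem_strongL1 (pair_mem_strongL1 (fun i => hS i n) (h n)) hQ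
  have hWpi := integrable_coeFn_add hWi hpi
  -- The extreme value is finite, so the total position is integrable; subtracting the integrable `W
  -- n + ⟨h n, S⟩` leaves `X n`.
  have hXi : Integrable (X n) Q.1 := by
    have := integrable_coeFn_add (integrable_coeFn_neg hWpi) (integrable_of_expect_ne hbot htop)
    rwa [add_right_comm, neg_add_cancel_left] at this
  -- Linearity enters here, through `-X n ∈ A n`.
  have hX0 : 0 ≤ ∫ ω, X n ω ∂Q.1 := by
    obtain ⟨V, hV⟩ := hlin n
    have hneg : -X n ∈ (A n : Set (Ω →ₘ[P] ℝ)) := by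
      have hXV : X n ∈ (A n : Set (Ω →ₘ[P] ℝ)) := ha.1 n
      rw [← hV] at hXV ⊢
      exact V.neg_mem hXV
    have := hQA _ hneg
    rw [expect_of_integrable (integrable_coeFn_neg hXi), integral_coeFn_neg] at this
    have : -∫ ω, X n ω ∂Q.1 ≤ 0 := by exact_mod_cast this
    linarith
  rw [utility_shift (hu n), utility_shift (hu n)]
  calc u n (W n + ξ + pair η S) + ((-(η ⬝ᵥ meanVec Q S) : ℝ) : EReal)
      ≤ ((∫ ω, W n ω ∂Q.1 + η ⬝ᵥ meanVec Q S : ℝ) : EReal) +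
          ((-(η ⬝ᵥ meanVec Q S) : ℝ) : EReal) := by
        gcongr
        exact (hQ _).trans (expect_le_of_riskNeutral (hW n) (fun i => hS i n) hQ hQA hξ η)
    _ ≤ ((∫ ω, W n ω ∂Q.1 + h n ⬝ᵥ meanVec Q S + ∫ ω, X n ω ∂Q.1 : ℝ) : EReal) +
          ((-(h n ⬝ᵥ meanVec Q S) : ℝ) : EReal) := by
        rw [← EReal.coe_add, ← EReal.coe_add, EReal.coe_le_coe_iff]
        linarith
    _ = u n (W n + X n + pair (h n) S) + ((-(h n ⬝ᵥ meanVec Q S) : ℝ) : EReal) := by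
        rw [utility_eq_iInf (hu n), ← hext, add_right_comm (W n) (X n),
          expect_of_integrable (integrable_coeFn_add hWpi hXi), integral_coeFn_add hWpi hXi,
          integral_coeFn_add hWi hpi, integral_pair (fun i => hS i n) hQ]

/-! ### Pareto dominance -/

/-- Transfers cancel in the sum, so a dominating position has total at most `M`; equality of totals
then excludes a strict gain. -/
theorem IsParetoEquilibrium.isUndominatedWithTransfers (hu : ∀ n, IsCoherentUtility (u n))
    (hM' : maxOverallUtility u A W S ≠ ⊥) (hM : maxOverallUtility u A W S < ⊤)
    (hX : IsParetoEquilibrium u A W S X h) : IsUndominatedWithTransfers u A W S X h := by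
  refine ⟨hX.1, ?_⟩
  rintro ⟨X', h', a, ha', hsum, hle, n, hlt⟩
  refine hlt.ne (EReal.eq_of_le_of_sum_le hle ?_ ?_ ?_ n)
  · simp only [utility_add_const (hu _)]
    rw [EReal.sum_add_coe, hsum, EReal.coe_zero, add_zero]
    exact (overallUtility_le_max ha').trans hX.2.ge
  · exact hX.2.trans_ne hM'
  · exact hX.2.trans_ne hM.ne

theorem IsUndominatedWithTransfers.isUndominated
    (hX : IsUndominatedWithTransfers u A W S X h) : IsUndominated u A W S X h := by
  refine ⟨hX.1, fun ⟨X', h', ha', hle, hlt⟩ => hX.2 ⟨X', h', 0, ha', by simp, ?_⟩⟩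
  have h0 : (AEEqFun.const Ω (0 : ℝ) : Ω →ₘ[P] ℝ) = 0 := rfl
  simpa only [Pi.zero_apply, h0, add_zero] using And.intro hle hlt

/-- A transfer `a n` is replicated by the holding `a n • v`, and these holdings add up to zero. -/
theorem IsUndominated.isUndominatedWithTransfers {v : Fin d → ℝ} (hv : pair v S = 1)
    (hX : IsUndominated u A W S X h) : IsUndominatedWithTransfers u A W S X h := by
  refine ⟨hX.1, ?_⟩
  rintro ⟨X', h', a, ha', hsum, hle, hlt⟩
  have hpair : ∀ n, W n + X' n + pair (h' n) S + AEEqFun.const Ω (a n) =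
      W n + X' n + pair (h' n + a n • v) S := fun n => by
    rw [pair_add, pair_smul, hv, ← add_assoc]
    congr 1
    change _ = (AEEqFun.const Ω (a n • (1 : ℝ)) : Ω →ₘ[P] ℝ)
    rw [smul_eq_mul, mul_one]
  simp only [hpair] at hle hlt
  refine hX.2 ⟨X', fun n => h' n + a n • v, ⟨ha'.1, ?_⟩, hle, hlt⟩
  rw [Finset.sum_add_distrib, ha'.2, ← Finset.sum_smul, hsum, zero_smul, add_zero]

/-- If another allocation has utilities `r n` with a larger total, real targets `c n` with the same
total as `r` can be chosen above the current utilities. The transfers `c n - r n` reach these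
targets, and some gain is strict because the totals differ. -/
theorem IsUndominatedWithTransfers.isParetoEquilibrium (hu : ∀ n, IsCoherentUtility (u n))
    (hD : ∀ n, IsWeaklyCompact (determiningSet (u n)))
    (hA : ∀ n, IsConsistent (determiningSet (u n)) (A n : Set (Ω →ₘ[P] ℝ)))
    (hW : ∀ n, W n ∈ StrongL1 (determiningSet (u n)))
    (hS : ∀ i n, S i ∈ StrongL1 (determiningSet (u n)))
    (hM : maxOverallUtility u A W S < ⊤)
    (hX : IsUndominatedWithTransfers u A W S X h) : IsParetoEquilibrium u A W S X h := by
  refine ⟨hX.1, le_antisymm (overallUtility_le_max hX.1) ?_⟩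
  refine iSup_le fun X' => iSup₂_le fun h' ha' => ?_
  by_contra! hlt
  have hsum' : overallUtility u W S X' h' ≠ ⊥ := (bot_le.trans_lt hlt).ne'
  have htop' : overallUtility u W S X' h' ≠ ⊤ := ((overallUtility_le_max ha').trans_lt hM).ne
  have hb' := EReal.ne_bot_of_sum_ne_bot hsum'
  have ht' := EReal.ne_top_of_sum_ne_top hb' htop'
  obtain ⟨p, hp⟩ := (maxOverallUtility_lt_top_iff hu hD hA hW hS).1 hM
  -- Current utilities may be `⊥`, but a risk-neutral measure excludes `⊤`.
  have ht : ∀ n, u n (W n + X n + pair (h n) S) ≠ ⊤ := fun n => by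
    obtain ⟨Q, hQ, -⟩ := (mem_gen_iff hD hA hS).1 hp n
    exact ne_top_of_le_ne_top (EReal.coe_ne_top _) ((hQ.1 _).trans
      (expect_le_of_riskNeutral (hW n) (fun i => hS i n) hQ.1 hQ.2 (hX.1.1 n) _))
  have : Nonempty (Fin N) := by
    by_contra hN
    rw [not_nonempty_iff] at hN
    simp [overallUtility] at hlt
  let r : Fin N → ℝ := fun n => (u n (W n + X' n + pair (h' n) S)).toReal
  have hr : ∀ n, u n (W n + X' n + pair (h' n) S) = r n := fun n =>
    (EReal.coe_toReal (ht' n) (hb' n)).symm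
  have hr' : overallUtility u W S X' h' = ((∑ n, r n : ℝ) : EReal) := by
    rw [EReal.coe_sum]
    exact Finset.sum_congr rfl fun n _ => hr n
  rw [hr'] at hlt
  obtain ⟨c, hc, hle⟩ := EReal.exists_sum_eq_of_sum_lt ht hlt
  have huc : ∀ n, u n (W n + X' n + pair (h' n) S + AEEqFun.const Ω (c n - r n)) = c n :=
    fun n => by rw [utility_add_const (hu n), hr, ← EReal.coe_add, add_sub_cancel]
  refine hX.2 ⟨X', h', fun n => c n - r n, ha', ?_, fun n => ?_, ?_⟩
  · rw [Finset.sum_sub_distrib, hc, sub_self]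
  · rw [huc]
    exact hle n
  · simp only [huc]
    by_contra! hge
    refine hlt.not_ge ?_
    rw [← hc, EReal.coe_sum]
    exact Finset.sum_le_sum fun n _ => hge n

end Agents

end CoherentRisk

/-! ### Assembly of the equivalences. -/

theorem mainTheorem2 {Ω : Type*} [MeasurableSpace Ω] (P : Measure Ω) [IsProbabilityMeasure P]
    (N d : ℕ)
    (u : Fin N → (Ω →ₘ[P] ℝ) → EReal)
    (hu : ∀ n, CoherentRisk.IsCoherentUtility (u n))
    (hD : ∀ n, CoherentRisk.IsWeaklyCompact (CoherentRisk.determiningSet (u n)))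
    (A : Fin N → PointedCone ℝ (Ω →ₘ[P] ℝ))
    (hA : ∀ n, CoherentRisk.IsConsistent (CoherentRisk.determiningSet (u n))
      (A n : Set (Ω →ₘ[P] ℝ)))
    (W : Fin N → (Ω →ₘ[P] ℝ))
    (hW : ∀ n, W n ∈ CoherentRisk.StrongL1 (CoherentRisk.determiningSet (u n)))
    (S : Fin d → (Ω →ₘ[P] ℝ))
    (hS : ∀ i n, S i ∈ CoherentRisk.StrongL1 (CoherentRisk.determiningSet (u n))) :
    (CoherentRisk.maxOverallUtility u A W S < ⊤ ↔ (CoherentRisk.gen u A S).Nonempty) ∧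
    (CoherentRisk.maxOverallUtility u A W S < ⊤ →
      ∀ (X : Fin N → (Ω →ₘ[P] ℝ)) (h : Fin N → Fin d → ℝ), CoherentRisk.IsAllocation A X h →
        -- (i) ⇔ (ii)
        (CoherentRisk.IsParetoEquilibrium u A W S X h ↔
          ∃ p : Fin d → ℝ, CoherentRisk.IsArrowDebreuEquilibrium u A W S X h p) ∧
        -- the set of equilibrium prices
        (CoherentRisk.IsParetoEquilibrium u A W S X h →
          CoherentRisk.equilibriumPrices u A W S X h = CoherentRisk.argminPrices u A W S) ∧
        -- linear cones
        ((∀ n, CoherentRisk.IsLinear (A n : Set (Ω →ₘ[P] ℝ))) →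
          (CoherentRisk.IsParetoEquilibrium u A W S X h ↔
            (CoherentRisk.dualPrices u A W S X h).Nonempty) ∧
          CoherentRisk.equilibriumPrices u A W S X h = CoherentRisk.dualPrices u A W S X h) ∧
        -- the global optimum in terms of Pareto dominance
        (CoherentRisk.IsParetoEquilibrium u A W S X h ↔
          CoherentRisk.IsUndominatedWithTransfers u A W S X h) ∧
        (CoherentRisk.IsParetoEquilibrium u A W S X h →
          CoherentRisk.IsUndominated u A W S X h) ∧
        ((∃ v : Fin d → ℝ, CoherentRisk.pair v S = 1) →
          (CoherentRisk.IsParetoEquilibrium u A W S X h ↔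
            CoherentRisk.IsUndominated u A W S X h))) := by

  refine ⟨CoherentRisk.maxOverallUtility_lt_top_iff hu hD hA hW hS, fun hM X h ha => ?_⟩
  have hM' := CoherentRisk.maxOverallUtility_ne_bot (A := A) (S := S) hu hD hW
  have h12 : CoherentRisk.IsParetoEquilibrium u A W S X h ↔
      ∃ p : Fin d → ℝ, CoherentRisk.IsArrowDebreuEquilibrium u A W S X h p := by
    refine ⟨fun hX => ?_, fun ⟨p, hp⟩ => hp.isParetoEquilibrium hu⟩
    obtain ⟨p, -, hp⟩ := CoherentRisk.exists_mem_gen_sum_agentFun_le hu hD hA hW hS hM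
    exact ⟨p, hX.isArrowDebreuEquilibrium hu hD hA hW hS hM hp⟩
  have h4 : CoherentRisk.IsParetoEquilibrium u A W S X h ↔
      CoherentRisk.IsUndominatedWithTransfers u A W S X h :=
    ⟨fun hX => hX.isUndominatedWithTransfers hu hM' hM,
      fun hX => hX.isParetoEquilibrium hu hD hA hW hS hM⟩
  refine ⟨h12, CoherentRisk.equilibriumPrices_eq_argminPrices hu hD hA hW hS hM, fun hlin => ?_,
    h4, fun hX => (h4.1 hX).isUndominated, fun ⟨v, hv⟩ =>
      ⟨fun hX => (h4.1 hX).isUndominated, fun hX => h4.2 (hX.isUndominatedWithTransfers hv)⟩⟩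
  have he : CoherentRisk.equilibriumPrices u A W S X h = CoherentRisk.dualPrices u A W S X h :=
    (CoherentRisk.equilibriumPrices_subset_dualPrices hu hD hA hW hS hM).antisymm
      (CoherentRisk.dualPrices_subset_equilibriumPrices hu hW hS hlin ha)
  exact ⟨h12.trans (he ▸ Iff.rfl), he⟩
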